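/- Let $\Omega\subset\mathbb{R}^3$ be a smooth bounded domain, $T_0>0$, $k\ge 1$ an integer and $\varepsilon>0$. Let $u:\Omega\times[0,T_0]\to\mathbb{S}^2\subset\mathbb{R}^3$ be a solution of the Landau–Lifshitz equation $$\partial_t u=u\times\Delta u \ \text{ in }\Omega\times[0,T_0],\qquad \frac{\partial u}{\partial\nu}=0\ \text{ on }\partial\Omega\times[0,T_0],$$ with $\partial_t^i u\in L^\infty([0,T_0],W^{2k+3-2i,2}(\Omega))$ for $0\le i\le k+1$. Let $\nabla$ be the pull-back connection on $u^*(T\mathbb{S}^2)$, so that $\nabla_t f$ and $\nabla_j f$ are the orthogonal projections of $\partial_t f$ and $\partial_j f$ to $T_u\mathbb{S}^2$. Put $v_i=\nabla_t^i u$ (with $v_0=u$, $v_1=\partial_t u$) and $\tau(u)=\Delta u+|\partial u|^2u$, and let $R_k$ be the section of $u^*(T\mathbb{S}^2)$ defined by $$\nabla_t^k\tau(u)=\sum_{j=1}^3\nabla_j\nabla_j v_k+\sum_{j=1}^3R^{\mathbb{S}^2}(v_k,\partial_ju)\partial_ju+R_k,\qquad R^{\mathbb{S}^2}(X,Y)Z=\langle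 Y,Z\rangle X-\langle X,Z\rangle Y.$$ Let $\omega_\varepsilon\in C^0([0,T_0],W^{2,2}(\Omega,\mathbb{R}^3))\cap L^2([0,T_0],W^{3,2}(\Omega,\mathbb{R}^3))$ be a (strong) solution of $$\begin{cases}\partial_t\omega_\varepsilon+\langle\omega_\varepsilon,v_1\rangle u=\varepsilon\big(\Delta\omega_\varepsilon+2\langle\partial u,\partial\omega_\varepsilon\rangle u+\langle\Delta u,\omega_\varepsilon\rangle u+|\partial u|^2\omega_\varepsilon\big)+u\times\big(\Delta\omega_\varepsilon+|\partial u|^2\omega_\varepsilon\big)+(\varepsilon I+u\times)R_k,\\[1ex] \dfrac{\partial\omega_\varepsilon}{\partial\nu}\Big|_{\partial\Omega}=0,\\[1ex] \omega_\varepsilon(0)=v_k(0).\end{cases}$$ Then $\langle\omega_\varepsilon,u\rangle(x,t)=0$ for all $(x,t)\in\overline\Omega\times[0,T_0]$. That is, for every $t\in[0,T_0]$, $\langle\omega_\varepsilon(\cdot,t),u(\cdot,t)\rangle=0$ almost everywhere in $\Omega$, and the continuous representatives of $\omega_\varepsilon(\cdot,t)$ and $u(\cdot,t)$ on $\overline\Omega$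 satisfy this identity at every point of $\overline\Omega$. -/

import Mathlib

open MeasureTheory Set

noncomputable section

namespace LLFlow

/-- Euclidean three-space, both the space of the variable `x` and the space of values. -/
abbrev E3 : Type := EuclideanSpace ℝ (Fin 3)

/-- The inner product of `ℝ³`. -/
def dot (a b : E3) : ℝ := inner ℝ a b

/-- The cross product of `ℝ³`. -/
def cross (a b : E3) : E3 :=
  WithLp.toLp 2 (crossProduct (WithLp.ofLp a) (WithLp.ofLp b))

section Smooth

open scoped ContDiff

/-- A smooth bounded domain of `ℝ³`: open, connected, nonempty, bounded, and near each boundary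
point equal to a sublevel set `{ρ < 0}` of a smooth function with nonvanishing derivative. -/
structure IsSmoothBoundedDomain (Ω : Set E3) : Prop where
  isOpen : IsOpen Ω
  isConnected : IsConnected Ω
  isBounded : Bornology.IsBounded Ω
  smooth_boundary : ∀ x ∈ frontier Ω, ∃ (N : Set E3) (ρ : E3 → ℝ),
    IsOpen N ∧ x ∈ N ∧ ContDiff ℝ ∞ ρ ∧ fderiv ℝ ρ x ≠ 0 ∧ Ω ∩ N = {y | ρ y < 0} ∩ N

/-- The Hilbert space `L²(Ω, ℝ³)`. -/
abbrev L2 (Ω : Set E3) : Type := Lp E3 2 (volume.restrict Ω)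

open Classical in
/-- The element of `L²(Ω, ℝ³)` given by a square integrable function (zero if the function is not
square integrable). -/
def ofFun (Ω : Set E3) (g : E3 → E3) : L2 Ω :=
  if h : MemLp g 2 (volume.restrict Ω) then h.toLp g else 0

/-- `g` is the weak partial derivative `∂_j f` on `Ω`. -/
def IsWeakPartial (Ω : Set E3) (j : Fin 3) (f g : L2 Ω) : Prop :=
  ∀ φ : E3 → ℝ, ContDiff ℝ ∞ φ → HasCompactSupport φ → tsupport φ ⊆ Ω →
    ∫ x in Ω, (fderiv ℝ φ x (EuclideanSpace.single j 1)) • f x = -∫ x in Ω, φ x • g x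

theorem IsWeakPartial.unique {Ω : Set E3} (hΩ : IsOpen Ω) {j : Fin 3} {f g g' : L2 Ω}
    (h : IsWeakPartial Ω j f g) (h' : IsWeakPartial Ω j f g') : g = g' := by
  have hloc : ∀ w : L2 Ω, LocallyIntegrableOn (fun x => w x) Ω volume := by
    intro w
    exact locallyIntegrableOn_of_locallyIntegrable_restrict
      ((Lp.memLp w).locallyIntegrable (by norm_num))
  have hint : ∀ (w : L2 Ω) (φ : E3 → ℝ), ContDiff ℝ ∞ φ → HasCompactSupport φ →
      Integrable (fun x => φ x • w x) (volume.restrict Ω) := by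
    intro w φ hφ hc
    exact ((Lp.memLp w).locallyIntegrable (by norm_num)).integrable_smul_left_of_hasCompactSupport
      hφ.continuous hc
  have key := hΩ.ae_eq_zero_of_integral_contDiff_smul_eq_zero (μ := volume)
    (f := fun x => g x - g' x) ((hloc g).sub (hloc g')) (by
      intro φ hφ hc hs
      have e := (h φ hφ hc hs).symm.trans (h' φ hφ hc hs)
      have e2 : ∫ x, φ x • (g x - g' x) = ∫ x in Ω, φ x • (g x - g' x) := by
        refine (setIntegral_eq_integral_of_forall_compl_eq_zero fun x hx => ?_).symm
        have : φ x = 0 := by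
          by_contra hne
          exact hx (hs (subset_tsupport _ hne))
        simp [this]
      rw [e2]
      simp only [smul_sub]
      rw [integral_sub (hint g φ hφ hc) (hint g' φ hφ hc), neg_inj.mp e, sub_self])
  apply Lp.ext
  rw [Filter.EventuallyEq, ae_restrict_iff' hΩ.measurableSet]
  filter_upwards [key] with x hx hxΩ
  exact sub_eq_zero.mp (hx hxΩ)

end Smooth

open Classical in
/-- The weak partial derivative `∂_j f ∈ L²(Ω)` (zero if there is none in `L²(Ω)`).  On an open set
it is unique, see `IsWeakPartial.unique`. -/
def wpd {Ω : Set E3} (j : Fin 3) (f : L2 Ω) : L2 Ω :=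
  if h : ∃ g, IsWeakPartial Ω j f g then h.choose else 0

theorem IsWeakPartial.wpd_eq {Ω : Set E3} (hΩ : IsOpen Ω) {j : Fin 3} {f g : L2 Ω}
    (h : IsWeakPartial Ω j f g) : wpd j f = g := by
  have hex : ∃ g, IsWeakPartial Ω j f g := ⟨g, h⟩
  rw [wpd, dif_pos hex]
  exact IsWeakPartial.unique hΩ hex.choose_spec h

/-- The iterated weak derivative along a list of coordinate directions. -/
def wpds {Ω : Set E3} (l : List (Fin 3)) (f : L2 Ω) : L2 Ω := l.foldr wpd f

/-- The weak Laplacian `Δ f = ∑_j ∂_j ∂_j f`. -/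
def wlap {Ω : Set E3} (f : L2 Ω) : L2 Ω := ∑ j, wpd j (wpd j f)

/-- Membership of `f ∈ L²(Ω, ℝ³)` in the Sobolev space `W^{m,2}(Ω, ℝ³)`. -/
def MemW {Ω : Set E3} : ℕ → L2 Ω → Prop
  | 0, _ => True
  | m + 1, f => ∀ j, ∃ g, IsWeakPartial Ω j f g ∧ MemW m g

/-- The curve `f` belongs to `C⁰([0,T], W^{m,2}(Ω))`. -/
def MemC0W {Ω : Set E3} (T : ℝ) (m : ℕ) (f : ℝ → L2 Ω) : Prop :=
  (∀ t ∈ Icc 0 T, MemW m (f t)) ∧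
    ∀ l : List (Fin 3), l.length ≤ m → ContinuousOn (fun t => wpds l (f t)) (Icc 0 T)

/-- The curve `f` belongs to `L^p([0,T], W^{m,2}(Ω))`. -/
def MemLpW {Ω : Set E3} (T : ℝ) (p : ENNReal) (m : ℕ) (f : ℝ → L2 Ω) : Prop :=
  (∀ᵐ t ∂(volume.restrict (Icc 0 T)), MemW m (f t)) ∧
    ∀ l : List (Fin 3), l.length ≤ m →
      MemLp (fun t => wpds l (f t)) p (volume.restrict (Icc 0 T))

/-- `f` is absolutely continuous from `[0,T]` to `L²(Ω)` with time derivative `∂_t f = g` in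
`L¹([0,T], L²(Ω))`.  Equivalently: `g` is the weak time derivative of `f`, and `f` is the continuous
representative in time. -/
def HasTimeDeriv {Ω : Set E3} (T : ℝ) (f g : ℝ → L2 Ω) : Prop :=
  IntegrableOn g (Icc 0 T) ∧ ∀ t ∈ Icc 0 T, f t = f 0 + ∫ s in (0 : ℝ)..t, g s

/-- The Neumann condition `∂f/∂ν = 0` on `∂Ω`, in the weak sense
`∫ ⟨Δ f, φ⟩ = - ∫ ⟨∂ f, ∂ φ⟩` for all `φ ∈ W^{1,2}(Ω, ℝ³)`. -/
def NeumannZero {Ω : Set E3} (f : L2 Ω) : Prop :=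
  ∀ φ : L2 Ω, MemW 1 φ →
    ∫ x in Ω, dot (wlap f x) (φ x) = -∫ x in Ω, ∑ j, dot (wpd j f x) (wpd j φ x)

/-- The orthogonal projection `f - ⟨f,u⟩u` of `f` to the tangent spaces of `S²` along `u`. -/
def tangProj {Ω : Set E3} (u f : L2 Ω) : L2 Ω :=
  ofFun Ω fun x => f x - dot (f x) (u x) • u x

/-- The pull-back connection on `u^*(TS²)` in the direction `x_j`: `∇_j f` is the tangential part
of `∂_j f`. -/
def covPartial {Ω : Set E3} (u : L2 Ω) (j : Fin 3) (f : L2 Ω) : L2 Ω := tangProj u (wpd j f)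

/-- The pull-back connection on `u^*(TS²)` in the direction `t`: `g = ∇_t f` is the tangential part
of `∂_t f`. -/
def HasCovTimeDeriv {Ω : Set E3} (T : ℝ) (u f g : ℝ → L2 Ω) : Prop :=
  ∃ f' : ℝ → L2 Ω, HasTimeDeriv T f f' ∧
    ∀ᵐ t ∂(volume.restrict (Icc 0 T)), g t = tangProj (u t) (f' t)

/-- `F i = ∇_t^i f` for `0 ≤ i ≤ n`. -/
def IsCovTimeJet {Ω : Set E3} (T : ℝ) (u f : ℝ → L2 Ω) (n : ℕ) (F : ℕ → ℝ → L2 Ω) : Prop :=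
  F 0 = f ∧ ∀ i < n, HasCovTimeDeriv T u (F i) (F (i + 1))

/-- `|∂u|²`. -/
def energyDensity {Ω : Set E3} (u : L2 Ω) (x : E3) : ℝ := ∑ j, ‖wpd j u x‖ ^ 2

/-- The tension field `τ(u) = Δu + |∂u|² u`. -/
def tension {Ω : Set E3} (u : L2 Ω) : L2 Ω :=
  ofFun Ω fun x => wlap u x + energyDensity u x • u x

/-- The curvature tensor of the unit sphere, `R(X,Y)Z = ⟨Y,Z⟩X - ⟨X,Z⟩Y`. -/
def curvS2 (X Y Z : E3) : E3 := dot Y Z • X - dot X Z • Y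

/-- The remainder `R_k`, at a fixed time: if `v = ∇_t^k u` and `θ = ∇_t^k τ(u)`, then
`∇_t^k τ(u) = ∑_j ∇_j ∇_j v + ∑_j R(v, ∂_j u) ∂_j u + R_k`. -/
def remainder {Ω : Set E3} (u v θ : L2 Ω) (x : E3) : E3 :=
  θ x - ∑ j, covPartial u j (covPartial u j v) x
    - ∑ j, curvS2 (v x) (wpd j u x) (wpd j u x)

/-- `u` is a solution on `[0,T]` of the Landau-Lifshitz equation `∂_t u = u × Δu`, with values in
`S²` and with Neumann boundary condition. -/
structure IsLLSolution {Ω : Set E3} (T : ℝ) (u : ℝ → L2 Ω) : Prop where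
  sphere : ∀ᵐ t ∂(volume.restrict (Icc 0 T)), ∀ᵐ x ∂(volume.restrict Ω), ‖u t x‖ = 1
  eqn : ∃ u' : ℝ → L2 Ω, HasTimeDeriv T u u' ∧
    ∀ᵐ t ∂(volume.restrict (Icc 0 T)), ∀ᵐ x ∂(volume.restrict Ω),
      u' t x = cross (u t x) (wlap (u t) x)
  neumann : ∀ᵐ t ∂(volume.restrict (Icc 0 T)), NeumannZero (u t)

/-- `∂_t^i u ∈ L^∞([0,T], W^{2k+3-2i,2}(Ω))` for `0 ≤ i ≤ k+1`. -/
def PropertyT {Ω : Set E3} (T : ℝ) (k : ℕ) (u : ℝ → L2 Ω) : Prop :=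
  ∃ D : ℕ → ℝ → L2 Ω, D 0 = u ∧ (∀ i ≤ k, HasTimeDeriv T (D i) (D (i + 1))) ∧
    ∀ i ≤ k + 1, MemLpW T ⊤ (2 * k + 3 - 2 * i) (D i)

/-- `ω` is a solution on `[0,T]` of the approximate problem
`∂_t ω + ⟨ω,v₁⟩u = ε(Δω + 2⟨∂u,∂ω⟩u + ⟨Δu,ω⟩u + |∂u|²ω) + u × (Δω + |∂u|²ω) + (εI + u×)R`,
`∂ω/∂ν = 0` on `∂Ω`, `ω(0) = w₀`. -/
structure IsApproxSolution {Ω : Set E3} (T ε : ℝ) (u v₁ : ℝ → L2 Ω) (R : ℝ → E3 → E3) (w₀ : L2 Ω)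
    (ω : ℝ → L2 Ω) : Prop where
  eqn : ∃ ω' : ℝ → L2 Ω, HasTimeDeriv T ω ω' ∧
    ∀ᵐ t ∂(volume.restrict (Icc 0 T)), ∀ᵐ x ∂(volume.restrict Ω),
      ω' t x + dot (ω t x) (v₁ t x) • u t x =
        ε • (wlap (ω t) x + (2 * ∑ j, dot (wpd j (u t) x) (wpd j (ω t) x)) • u t x
              + dot (wlap (u t) x) (ω t x) • u t x + energyDensity (u t) x • ω t x)
          + cross (u t x) (wlap (ω t) x + energyDensity (u t) x • ω t x)
          + (ε • R t x + cross (u t x) (R t x))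
  neumann : ∀ᵐ t ∂(volume.restrict (Icc 0 T)), NeumannZero (ω t)
  initial : ω 0 = w₀

end LLFlow

end

open LLFlow

/-! Put h = ⟨ω,u⟩. Pairing the approximate equation with u kills the two cross product terms, and
also the remainder, because R_k is tangent to the sphere along u. Since ∂_t u = u × Δu is orthogonal
to u, the projection v₁ equals ∂_t u, and ⟨ω,v₁⟩ is exactly what completes ⟨∂_t ω,u⟩ to ∂_t h. There
remains the linear equation ∂_t h = ε(Δh + |∂u|²h), with Neumann condition and zero initial value,
because v_k(0) is tangent. Testing with h gives d/dt ∫h² ≤ 6εM² ∫h², where M bounds every |∂_j u|,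
and Grönwall's inequality forces h = 0. The carriers are `dot_time_deriv`, `energy_inequality` and
`dot_eq_zero_of_energy`.

The Laplacian of h is never formed. The weak Neumann identity of ω is tested with hu and that of u
with hω; by the Leibniz rule the gradient terms then collapse to -∑(∂_j h)².

These test functions lie in W^{1,2} because all factors and their first derivatives are bounded.
That comes from the embedding W^{2,2} ⊂ L^∞ (`IsSmoothBoundedDomain.sobolev`), applied to ω, ∂_j ω
and ∂_j u, and proved by averaging a second order Taylor formula over a cone inside Ω.

In time, ω and u are only absolutely continuous with values in L². The increments of ∫h² are
therefore written as pairings that are linear in the increments of ω and u (`pairEnergy_sub`), and a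
chain rule for such expressions (`sub_eq_integral_of_increment_eq`) supplies the integrated energy
identity. -/

noncomputable section

namespace LLFlow

open scoped ContDiff Convolution Topology
open Filter ContinuousLinearMap

/-! ### Mollification and weak derivatives -/

section Mollification

variable {V : Type*} [NormedAddCommGroup V] [NormedSpace ℝ V]

/-- `g` is the weak partial derivative `∂_j f` on `Ω`, for functions with values in a normed space. -/
def WeakPartial (Ω : Set E3) (j : Fin 3) (f g : E3 → V) : Prop :=
  ∀ φ : E3 → ℝ, ContDiff ℝ ∞ φ → HasCompactSupport φ → tsupport φ ⊆ Ω →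
    ∫ x in Ω, (fderiv ℝ φ x (EuclideanSpace.single j 1)) • f x = -∫ x in Ω, φ x • g x

/-- A standard bump function supported in the ball of radius `1 / (n + 1)`. -/
def mollBump (n : ℕ) : ContDiffBump (0 : E3) where
  rIn := 1 / (n + 1) / 2
  rOut := 1 / (n + 1)
  rIn_pos := by positivity
  rIn_lt_rOut := by
    have : (0 : ℝ) < 1 / (n + 1) := by positivity
    linarith

/-- The mollifier at scale `1 / (n + 1)`. -/
def mollKer (n : ℕ) : E3 → ℝ := (mollBump n).normed volume

/-- Mollification at scale `1 / (n + 1)`. -/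
def moll (n : ℕ) (f : E3 → V) : E3 → V := mollKer n ⋆[lsmul ℝ ℝ, volume] f

theorem mollKer_contDiff (n : ℕ) : ContDiff ℝ ∞ (mollKer n) := (mollBump n).contDiff_normed

theorem mollKer_hasCompactSupport (n : ℕ) : HasCompactSupport (mollKer n) :=
  (mollBump n).hasCompactSupport_normed

theorem mollKer_nonneg (n : ℕ) (x : E3) : 0 ≤ mollKer n x := (mollBump n).nonneg_normed x

theorem integral_mollKer (n : ℕ) : ∫ x, mollKer n x = 1 := (mollBump n).integral_normed

theorem integrable_mollKer (n : ℕ) : Integrable (mollKer n) := (mollBump n).integrable_normed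

theorem tsupport_mollKer (n : ℕ) : tsupport (mollKer n) = Metric.closedBall 0 (1 / (n + 1)) :=
  (mollBump n).tsupport_normed_eq

theorem lintegral_mollKer (n : ℕ) : ∫⁻ x, ‖mollKer n x‖ₑ = 1 := by
  have h := ofReal_integral_eq_lintegral_ofReal (integrable_mollKer n)
    (Eventually.of_forall (mollKer_nonneg n))
  rw [integral_mollKer, ENNReal.ofReal_one] at h
  rw [h]
  refine lintegral_congr fun x => ?_
  rw [Real.enorm_eq_ofReal (mollKer_nonneg n x)]

theorem moll_apply (n : ℕ) (f : E3 → V) (x : E3) :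
    moll n f x = ∫ y, mollKer n y • f (x - y) := rfl

theorem moll_apply_swap (n : ℕ) (f : E3 → V) (x : E3) :
    moll n f x = ∫ y, mollKer n (x - y) • f y := by
  rw [moll, convolution_eq_swap]; rfl

theorem moll_contDiff (n : ℕ) {f : E3 → V} (hf : LocallyIntegrable f) :
    ContDiff ℝ ∞ (moll n f) :=
  (mollKer_hasCompactSupport n).contDiff_convolution_left _ (mollKer_contDiff n) hf

theorem moll_enorm_le (n : ℕ) (f : E3 → V) (x : E3) :
    ‖moll n f x‖ₑ ≤ ∫⁻ y, ‖mollKer n y‖ₑ * ‖f (x - y)‖ₑ := by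
  rw [moll_apply]
  refine (enorm_integral_le_lintegral_enorm _).trans_eq ?_
  simp only [enorm_smul]

theorem moll_norm_le (n : ℕ) {f : E3 → V} {M : ℝ} (hM : ∀ᵐ x, ‖f x‖ ≤ M) (x : E3) :
    ‖moll n f x‖ ≤ M := by
  rw [moll_apply_swap]
  have hi : Integrable fun y => mollKer n (x - y) * M :=
    ((integrable_mollKer n).comp_sub_left x).mul_const M
  refine (norm_integral_le_of_norm_le hi ?_).trans_eq ?_
  · filter_upwards [hM] with y hy
    rw [norm_smul, Real.norm_of_nonneg (mollKer_nonneg n _)]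
    exact mul_le_mul_of_nonneg_left hy (mollKer_nonneg n _)
  · rw [integral_mul_const, integral_sub_left_eq_self (mollKer n) volume x, integral_mollKer,
      one_mul]

theorem moll_tendsto [CompleteSpace V] {f : E3 → V} (hf : LocallyIntegrable f) :
    ∀ᵐ x, Tendsto (fun n => moll n f x) atTop (𝓝 (f x)) := by
  -- `K` bounds the ratio of outer to inner radius, which is 2 for every bump in the family.
  refine ContDiffBump.ae_convolution_tendsto_right_of_locallyIntegrable (φ := mollBump) (K := 2)
    ?_ ?_ hf
  · exact tendsto_one_div_add_atTop_nhds_zero_nat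
  · refine Eventually.of_forall fun n => ?_
    simp only [mollBump]
    linarith

/-- The derivative falls on the kernel, and the reflected kernel centred at x is an admissible test
function because its support is a ball inside Ω. The sign from the reflection cancels the sign in
the definition of the weak derivative. -/
theorem moll_fderiv [CompleteSpace V] {Ω : Set E3} (hΩ : IsOpen Ω) {j : Fin 3} {f g : E3 → V}
    (hf : IntegrableOn f Ω) (h : WeakPartial Ω j f g) {n : ℕ} {x : E3}
    (hx : Metric.closedBall x (1 / (n + 1)) ⊆ Ω) :
    fderiv ℝ (moll n (Ω.indicator f)) x (EuclideanSpace.single j 1)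
      = moll n (Ω.indicator g) x := by
  have hfi : Integrable (Ω.indicator f) := (integrable_indicator_iff hΩ.measurableSet).2 hf
  have hc1 : ContDiff ℝ 1 (mollKer n) := (mollKer_contDiff n).of_le (by exact_mod_cast le_top)
  have hd := (mollKer_hasCompactSupport n).hasFDerivAt_convolution_right
    (lsmul ℝ ℝ : ℝ →L[ℝ] V →L[ℝ] V).flip hfi.locallyIntegrable hc1 x
  rw [convolution_flip] at hd
  have hd' : fderiv ℝ (moll n (Ω.indicator f)) x = _ := hd.fderiv
  rw [hd', convolution_precompR_apply _ hfi.locallyIntegrable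
    ((mollKer_hasCompactSupport n).fderiv ℝ) (hc1.continuous_fderiv one_ne_zero)]
  have hφ : ContDiff ℝ ∞ fun y => mollKer n (x - y) :=
    (mollKer_contDiff n).comp (contDiff_const.sub contDiff_id)
  have hts : tsupport (fun y => mollKer n (x - y)) ⊆ Metric.closedBall x (1 / (n + 1)) := by
    refine closure_minimal (fun y hy => ?_) Metric.isClosed_closedBall
    have : x - y ∈ tsupport (mollKer n) := subset_tsupport _ hy
    rw [tsupport_mollKer, mem_closedBall_zero_iff] at this
    rwa [Metric.mem_closedBall, dist_comm, dist_eq_norm]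
  have hcs : HasCompactSupport fun y => mollKer n (x - y) :=
    HasCompactSupport.of_support_subset_isCompact (isCompact_closedBall x (1 / (n + 1)))
      ((subset_tsupport _).trans hts)
  have key := h _ hφ hcs (hts.trans hx)
  have hder : ∀ y, fderiv ℝ (fun y => mollKer n (x - y)) y (EuclideanSpace.single j 1)
      = - fderiv ℝ (mollKer n) (x - y) (EuclideanSpace.single j 1) := by
    intro y
    have h1 : HasFDerivAt (fun y : E3 => x - y) (-ContinuousLinearMap.id ℝ E3) y :=
      (hasFDerivAt_id y).const_sub x
    have h2 := ((hc1.differentiable one_ne_zero (x - y)).hasFDerivAt).comp y h1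
    have h3 : HasFDerivAt (fun y => mollKer n (x - y)) _ y := h2
    rw [h3.fderiv]
    simp
  simp only [hder, neg_smul, integral_neg, neg_inj] at key
  rw [moll_apply_swap, convolution_def]
  have e1 : ∀ (a : E3 → ℝ) (f : E3 → V), ∫ y in Ω, a y • f y = ∫ y, a y • Ω.indicator f y := by
    intro a f
    rw [← integral_indicator hΩ.measurableSet]
    congr 1
    ext y
    rw [Set.indicator_smul_apply]
  rw [e1, e1] at key
  simpa using key

end Mollification

/-! ### Leibniz rule for bounded functions -/

section ProductRule

variable {V : Type*} [NormedAddCommGroup V]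
  {V₁ : Type*} [NormedAddCommGroup V₁] [NormedSpace ℝ V₁]
  {V₂ : Type*} [NormedAddCommGroup V₂] [NormedSpace ℝ V₂]
  {V₃ : Type*} [NormedAddCommGroup V₃] [NormedSpace ℝ V₃]

/-- `f` is measurable and essentially bounded on `Ω`. -/
structure EssBdd (Ω : Set E3) (f : E3 → V) : Prop where
  meas : AEStronglyMeasurable f (volume.restrict Ω)
  bdd : ∃ M : ℝ, ∀ᵐ x ∂(volume.restrict Ω), ‖f x‖ ≤ M

theorem EssBdd.add {Ω : Set E3} {f g : E3 → V} (hf : EssBdd Ω f) (hg : EssBdd Ω g) :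
    EssBdd Ω fun x => f x + g x := by
  obtain ⟨M, hM⟩ := hf.bdd
  obtain ⟨N, hN⟩ := hg.bdd
  refine ⟨hf.meas.add hg.meas, M + N, ?_⟩
  filter_upwards [hM, hN] with x h1 h2
  exact (norm_add_le _ _).trans (add_le_add h1 h2)

theorem EssBdd.sum {Ω : Set E3} {ι : Type*} (s : Finset ι) {f : ι → E3 → V}
    (hf : ∀ i ∈ s, EssBdd Ω (f i)) : EssBdd Ω fun x => ∑ i ∈ s, f i x := by
  classical
  induction s using Finset.induction_on with
  | empty => exact ⟨by simpa using aestronglyMeasurable_const, 0, by simp⟩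
  | insert a s ha ih =>
    simp only [Finset.sum_insert ha]
    exact (hf a (Finset.mem_insert_self a s)).add
      (ih fun i hi => hf i (Finset.mem_insert_of_mem hi))

theorem EssBdd.bilin {Ω : Set E3} (B : V₁ →L[ℝ] V₂ →L[ℝ] V₃) {f : E3 → V₁} {g : E3 → V₂}
    (hf : EssBdd Ω f) (hg : EssBdd Ω g) : EssBdd Ω fun x => B (f x) (g x) := by
  obtain ⟨M, hM⟩ := hf.bdd
  obtain ⟨N, hN⟩ := hg.bdd
  refine ⟨B.aestronglyMeasurable_comp₂ hf.meas hg.meas, ‖B‖ * M * N, ?_⟩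
  filter_upwards [hM, hN] with x h1 h2
  refine (B.le_opNorm₂ _ _).trans ?_
  have := (norm_nonneg _).trans h1
  gcongr

theorem EssBdd.integrableOn {Ω : Set E3} (hb : Bornology.IsBounded Ω) {f : E3 → V}
    (hf : EssBdd Ω f) : IntegrableOn f Ω := by
  obtain ⟨M, hM⟩ := hf.bdd
  have : IsFiniteMeasure (volume.restrict Ω) := ⟨by simpa using hb.measure_lt_top⟩
  exact Integrable.of_bound hf.meas M hM

theorem EssBdd.memLp {Ω : Set E3} (hb : Bornology.IsBounded Ω) {f : E3 → V}
    (hf : EssBdd Ω f) (p : ENNReal) : MemLp f p (volume.restrict Ω) := by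
  obtain ⟨M, hM⟩ := hf.bdd
  have : IsFiniteMeasure (volume.restrict Ω) := ⟨by simpa using hb.measure_lt_top⟩
  exact MemLp.of_bound hf.meas M hM

theorem EssBdd.moll_bound [NormedSpace ℝ V] {Ω : Set E3} (hΩ : IsOpen Ω) {f : E3 → V}
    (hf : EssBdd Ω f) :
    ∃ M : ℝ, 0 ≤ M ∧ ∀ n x, ‖moll n (Ω.indicator f) x‖ ≤ M := by
  obtain ⟨M, hM⟩ := hf.bdd
  refine ⟨max M 0, le_max_right _ _, fun n x => moll_norm_le n ?_ x⟩
  rw [ae_restrict_iff' hΩ.measurableSet] at hM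
  filter_upwards [hM] with y hy
  by_cases hyΩ : y ∈ Ω
  · simpa [hyΩ] using Or.inl (hy hyΩ)
  · simp [hyΩ]

/-- Mollification preserves the essential bounds uniformly in n, so almost everywhere convergence
suffices for dominated convergence. -/
theorem tendsto_setIntegral_smul_bilin_moll [CompleteSpace V₁] [CompleteSpace V₂] {Ω : Set E3}
    (hΩ : IsOpen Ω) (hb : Bornology.IsBounded Ω) (B : V₁ →L[ℝ] V₂ →L[ℝ] V₃) {f : E3 → V₁} {g : E3 → V₂}
    (hf : EssBdd Ω f) (hg : EssBdd Ω g) {a : E3 → ℝ} (ha : Integrable a) :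
    Tendsto (fun n => ∫ x in Ω, a x • B (moll n (Ω.indicator f) x) (moll n (Ω.indicator g) x))
      atTop (𝓝 (∫ x in Ω, a x • B (f x) (g x))) := by
  have hfi : LocallyIntegrable (Ω.indicator f) :=
    ((integrable_indicator_iff hΩ.measurableSet).2 (hf.integrableOn hb)).locallyIntegrable
  have hgi : LocallyIntegrable (Ω.indicator g) :=
    ((integrable_indicator_iff hΩ.measurableSet).2 (hg.integrableOn hb)).locallyIntegrable
  obtain ⟨M, hM0, hM⟩ := hf.moll_bound hΩ
  obtain ⟨N, hN0, hN⟩ := hg.moll_bound hΩ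
  refine tendsto_integral_of_dominated_convergence (fun x => ‖a x‖ * (‖B‖ * M * N)) ?_ ?_ ?_ ?_
  · intro n
    exact ha.aestronglyMeasurable.restrict.smul (B.aestronglyMeasurable_comp₂
      (moll_contDiff n hfi).continuous.aestronglyMeasurable
      (moll_contDiff n hgi).continuous.aestronglyMeasurable)
  · exact (ha.norm.mul_const _).restrict
  · intro n
    refine Eventually.of_forall fun x => ?_
    rw [norm_smul]
    refine mul_le_mul_of_nonneg_left ((B.le_opNorm₂ _ _).trans ?_) (norm_nonneg _)
    have := hM n x
    have := hN n x
    gcongr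
  · rw [ae_restrict_iff' hΩ.measurableSet]
    filter_upwards [moll_tendsto hfi, moll_tendsto hgi] with x h1 h2 hx
    rw [indicator_of_mem hx] at h1 h2
    exact ((B.continuous₂.tendsto _).comp (h1.prodMk_nhds h2)).const_smul (a x)

/-- The Leibniz rule for bounded functions with bounded weak derivatives. -/
theorem WeakPartial.bilin [CompleteSpace V₁] [CompleteSpace V₂] {Ω : Set E3}
    (hΩ : IsOpen Ω) (hb : Bornology.IsBounded Ω) {j : Fin 3}
    (B : V₁ →L[ℝ] V₂ →L[ℝ] V₃) {f f' : E3 → V₁} {g g' : E3 → V₂}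
    (hf : EssBdd Ω f) (hf' : EssBdd Ω f') (hg : EssBdd Ω g) (hg' : EssBdd Ω g')
    (hff' : WeakPartial Ω j f f') (hgg' : WeakPartial Ω j g g') :
    WeakPartial Ω j (fun x => B (f x) (g x)) (fun x => B (f' x) (g x) + B (f x) (g' x)) := by
  intro φ hφ hc hs
  have hfi : LocallyIntegrable (Ω.indicator f) :=
    ((integrable_indicator_iff hΩ.measurableSet).2 (hf.integrableOn hb)).locallyIntegrable
  have hgi : LocallyIntegrable (Ω.indicator g) :=
    ((integrable_indicator_iff hΩ.measurableSet).2 (hg.integrableOn hb)).locallyIntegrable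
  have hf'i : LocallyIntegrable (Ω.indicator f') :=
    ((integrable_indicator_iff hΩ.measurableSet).2 (hf'.integrableOn hb)).locallyIntegrable
  have hg'i : LocallyIntegrable (Ω.indicator g') :=
    ((integrable_indicator_iff hΩ.measurableSet).2 (hg'.integrableOn hb)).locallyIntegrable
  have hφi : Integrable φ := hφ.continuous.integrable_of_hasCompactSupport hc
  have hφd : Continuous fun x => fderiv ℝ φ x (EuclideanSpace.single j 1) :=
    (hφ.continuous_fderiv (by simp)).clm_apply continuous_const
  have hφdc : HasCompactSupport fun x => fderiv ℝ φ x (EuclideanSpace.single j 1) :=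
    hc.fderiv_apply ℝ _
  have hφ'i := hφd.integrable_of_hasCompactSupport (μ := volume) hφdc
  -- The support of φ keeps a distance δ from the complement of Ω. Once the mollification radius is
  -- at most δ, mollification commutes with the weak derivative at every point that φ sees.
  obtain ⟨δ, hδ, hK⟩ := hc.isCompact.exists_cthickening_subset_open hΩ hs
  have hsmall : ∀ᶠ n : ℕ in atTop, (1 : ℝ) / (n + 1) ≤ δ :=
    (tendsto_one_div_add_atTop_nhds_zero_nat.eventually (ge_mem_nhds hδ))
  have hl := tendsto_setIntegral_smul_bilin_moll hΩ hb B hf hg hφ'i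
  have hr := ((tendsto_setIntegral_smul_bilin_moll hΩ hb B hf' hg hφi).add
    (tendsto_setIntegral_smul_bilin_moll hΩ hb B hf hg' hφi)).neg
  have hint : ∀ {u : E3 → V₁} {w : E3 → V₂}, EssBdd Ω u → EssBdd Ω w →
      Integrable (fun x => φ x • B (u x) (w x)) (volume.restrict Ω) := by
    intro u w hu hw
    have h1 := (hu.bilin B hw)
    obtain ⟨M, hM⟩ := h1.bdd
    exact hφi.restrict.smul_bdd M h1.meas hM
  simp only [smul_add]
  rw [integral_add (hint hf' hg) (hint hf hg')]
  refine tendsto_nhds_unique (hl.congr' ?_) hr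
  filter_upwards [hsmall] with n hn
  set F := moll n (Ω.indicator f)
  set G := moll n (Ω.indicator g)
  have hF : ContDiff ℝ ∞ F := moll_contDiff n hfi
  have hG : ContDiff ℝ ∞ G := moll_contDiff n hgi
  have hF' : ContDiff ℝ ∞ (moll n (Ω.indicator f')) := moll_contDiff n hf'i
  have hG' : ContDiff ℝ ∞ (moll n (Ω.indicator g')) := moll_contDiff n hg'i
  have hFG : ContDiff ℝ ∞ fun x => B (F x) (G x) := B.isBoundedBilinearMap.contDiff.comp
    (hF.prodMk hG)
  have hd : ∀ x, fderiv ℝ (fun x => B (F x) (G x)) x (EuclideanSpace.single j 1)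
      = B (fderiv ℝ F x (EuclideanSpace.single j 1)) (G x)
        + B (F x) (fderiv ℝ G x (EuclideanSpace.single j 1)) := by
    intro x
    have := (B.hasFDerivAt_of_bilinear (hF.differentiable (by simp) x).hasFDerivAt
      (hG.differentiable (by simp) x).hasFDerivAt).fderiv
    rw [this]
    simp [add_comm]
  have hd' : ∀ x, φ x • fderiv ℝ (fun x => B (F x) (G x)) x (EuclideanSpace.single j 1)
      = φ x • B (moll n (Ω.indicator f') x) (G x)
        + φ x • B (F x) (moll n (Ω.indicator g') x) := by
    intro x
    by_cases hx : x ∈ tsupport φ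
    · have hball : Metric.closedBall x (1 / ((n : ℝ) + 1)) ⊆ Ω :=
        ((Metric.closedBall_subset_closedBall hn).trans
          (Metric.closedBall_subset_cthickening hx δ)).trans hK
      rw [hd, moll_fderiv hΩ (hf.integrableOn hb) hff' hball,
        moll_fderiv hΩ (hg.integrableOn hb) hgg' hball, smul_add]
    · simp [image_eq_zero_of_notMem_tsupport hx]
  have hzero : ∀ x ∉ Ω, φ x = 0 := fun x hx =>
    image_eq_zero_of_notMem_tsupport fun h => hx (hs h)
  have hzero' : ∀ x ∉ Ω, fderiv ℝ φ x (EuclideanSpace.single j 1) = 0 := fun x hx => by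
    rw [image_eq_zero_of_notMem_tsupport (f := fderiv ℝ φ)
      fun h => hx (hs (tsupport_fderiv_subset ℝ h))]
    simp
  have hI : ∀ {a : E3 → ℝ} {w : E3 → V₃}, Continuous a → HasCompactSupport a → Continuous w →
      Integrable fun x => a x • w x := fun ha hac hw =>
    (ha.smul hw).integrable_of_hasCompactSupport hac.smul_right
  have hBc : ∀ {u : E3 → V₁} {w : E3 → V₂}, Continuous u → Continuous w →
      Continuous fun x => B (u x) (w x) := fun hu hw => B.continuous₂.comp (hu.prodMk hw)
  rw [setIntegral_eq_integral_of_forall_compl_eq_zero fun x hx => by simp [hzero' x hx],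
    setIntegral_eq_integral_of_forall_compl_eq_zero fun x hx => by simp [hzero x hx],
    setIntegral_eq_integral_of_forall_compl_eq_zero fun x hx => by simp [hzero x hx],
    ← integral_add (hI hφ.continuous hc (hBc hF'.continuous hG.continuous))
      (hI hφ.continuous hc (hBc hF.continuous hG'.continuous))]
  simp only [← hd']
  -- Classical integration by parts for the smooth mollified product against φ.
  rw [integral_smul_fderiv_eq_neg_fderiv_smul_of_integrable (hI hφd hφdc hFG.continuous)
    (hI hφ.continuous hc ((hFG.continuous_fderiv (by simp)).clm_apply continuous_const))
    (hI hφ.continuous hc hFG.continuous) (fun x _ => hφ.differentiable (by simp) x)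
    (fun x _ => hFG.differentiable (by simp) x), neg_neg]

end ProductRule

/-! ### Sobolev embedding of W^{2,2} into L^∞ by the cone condition -/

section Sobolev

theorem lintegral_comp_add_smul {G : E3 → ENNReal} (hG : Measurable G) (c : E3) {s : ℝ}
    (hs : 0 < s) :
    ∫⁻ z, G (c + s • z) = ENNReal.ofReal (s ^ (-3 : ℝ)) * ∫⁻ z, G z := by
  have h1 : ∫⁻ z : E3, G (c + s • z) = ∫⁻ z, G (c + z) ∂(volume.map (s • · : E3 → E3)) := by
    rw [lintegral_map (by fun_prop) (by fun_prop)]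
  rw [h1, Measure.map_addHaar_smul _ hs.ne', lintegral_smul_measure, lintegral_add_left_eq_self]
  congr 2
  rw [finrank_euclideanSpace_fin, abs_of_pos (by positivity), Real.rpow_neg hs.le]
  norm_cast

/-- Cauchy–Schwarz on B, followed by scaling in dimension three: the factor s^{-3} becomes s^{-3/2}
under the square root. -/
theorem lintegral_comp_add_smul_le {G : E3 → ENNReal} (hG : Measurable G) (B : Set E3) (c : E3)
    {s : ℝ} (hs : 0 < s) :
    ∫⁻ z in B, G (c + s • z) ≤
      volume B ^ (1 / 2 : ℝ) *
        (ENNReal.ofReal (s ^ (-(3 / 2) : ℝ)) * (∫⁻ z, G z ^ (2 : ℝ)) ^ (1 / 2 : ℝ)) := by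
  have h := ENNReal.lintegral_mul_le_Lp_mul_Lq (volume.restrict B) (p := 2) (q := 2)
    Real.HolderConjugate.two_two (f := fun _ => 1) (g := fun z => G (c + s • z))
    aemeasurable_const (by fun_prop)
  simp only [Pi.mul_apply, one_mul, ENNReal.one_rpow, lintegral_const,
    Measure.restrict_apply MeasurableSet.univ, univ_inter] at h
  refine h.trans (mul_le_mul_right ?_ _)
  calc (∫⁻ z in B, G (c + s • z) ^ (2 : ℝ)) ^ (1 / 2 : ℝ)
      ≤ (∫⁻ z, G (c + s • z) ^ (2 : ℝ)) ^ (1 / 2 : ℝ) := by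
        gcongr
        exact Measure.restrict_le_self
    _ = (ENNReal.ofReal (s ^ (-3 : ℝ)) * ∫⁻ z, G z ^ (2 : ℝ)) ^ (1 / 2 : ℝ) := by
        rw [lintegral_comp_add_smul (G := fun z => G z ^ (2 : ℝ)) (hG.pow_const _) c hs]
    _ = _ := by
        rw [ENNReal.mul_rpow_of_nonneg _ _ (by norm_num),
          ENNReal.ofReal_rpow_of_nonneg (by positivity) (by norm_num), ← Real.rpow_mul hs.le]
        norm_num

/-- A mollification is an average of translates, and the preceding bound does not depend on the
translation. The kernel has mass one, so the constant is independent of n. -/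
theorem lintegral_moll_comp_add_smul_le {V : Type*} [NormedAddCommGroup V] [NormedSpace ℝ V]
    {g : E3 → V} (hg : StronglyMeasurable g) (n : ℕ) (B : Set E3) (x : E3)
    {s : ℝ} (hs : 0 < s) :
    ∫⁻ z in B, ‖moll n g (x + s • z)‖ₑ ≤
      volume B ^ (1 / 2 : ℝ) * (ENNReal.ofReal (s ^ (-(3 / 2) : ℝ)) * eLpNorm g 2 volume) := by
  have hG : Measurable fun y => ‖g y‖ₑ := hg.enorm
  have hk : Measurable fun y => ‖mollKer n y‖ₑ := (mollKer_contDiff n).continuous.measurable.enorm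
  set K := volume B ^ (1 / 2 : ℝ) *
    (ENNReal.ofReal (s ^ (-(3 / 2) : ℝ)) * eLpNorm g 2 volume) with hK
  calc ∫⁻ z in B, ‖moll n g (x + s • z)‖ₑ
      ≤ ∫⁻ z in B, ∫⁻ y, ‖mollKer n y‖ₑ * ‖g (x + s • z - y)‖ₑ :=
        lintegral_mono fun z => moll_enorm_le n g _
    _ = ∫⁻ y, ∫⁻ z in B, ‖mollKer n y‖ₑ * ‖g (x + s • z - y)‖ₑ := by
        refine lintegral_lintegral_swap (Measurable.aemeasurable ?_)
        refine (hk.comp measurable_snd).mul (hG.comp ?_)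
        fun_prop
    _ ≤ ∫⁻ y, ‖mollKer n y‖ₑ * K := by
        refine lintegral_mono fun y => ?_
        have hm : Measurable fun z : E3 => ‖g (x + s • z - y)‖ₑ :=
          hG.comp (f := fun z : E3 => x + s • z - y) (by fun_prop)
        rw [lintegral_const_mul _ hm]
        refine mul_le_mul_right ?_ _
        have := lintegral_comp_add_smul_le hG B (x - y) hs
        rw [hK, eLpNorm_eq_lintegral_rpow_enorm_toReal (by norm_num) (by norm_num)]
        simp only [ENNReal.toReal_ofNat]
        refine le_trans (le_of_eq ?_) this
        refine lintegral_congr fun z => ?_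
        congr 2
        abel
    _ = K := by rw [lintegral_mul_const _ hk, lintegral_mollKer, one_mul]

/-- The function p - s p' has derivative -s p'', so p(0) = p(1) - p'(1) + ∫ s p''. Expanding from
the far end puts the weight s on p'', which is what tames the scaling factor s^{-3/2} near the
vertex of the cone. -/
theorem enorm_le_taylor {V : Type*} [NormedAddCommGroup V] [NormedSpace ℝ V] [CompleteSpace V]
    {p p' p'' : ℝ → V} (h : ∀ s ∈ Icc (0 : ℝ) 1, HasDerivAt p (p' s) s)
    (h' : ∀ s ∈ Icc (0 : ℝ) 1, HasDerivAt p' (p'' s) s) (hc : Continuous p'') :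
    ‖p 0‖ₑ ≤ ‖p 1‖ₑ + ‖p' 1‖ₑ + ∫⁻ s in Ioc (0 : ℝ) 1, ENNReal.ofReal s * ‖p'' s‖ₑ := by
  have hd : ∀ s ∈ uIcc (0 : ℝ) 1, HasDerivAt (fun s => p s - s • p' s) (-(s • p'' s)) s := by
    intro s hs
    rw [uIcc_of_le zero_le_one] at hs
    have := (h s hs).sub ((hasDerivAt_id s).smul (h' s hs))
    convert! this using 1
    simp
  have hi := intervalIntegral.integral_eq_sub_of_hasDerivAt hd
    (Continuous.intervalIntegrable (by fun_prop) _ _)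
  have e : p 0 = p 1 - p' 1 + ∫ s in (0 : ℝ)..1, s • p'' s := by
    rw [intervalIntegral.integral_neg] at hi
    simp only [one_smul, zero_smul, sub_zero] at hi
    rw [← neg_eq_iff_eq_neg.mpr hi.symm]
    abel
  rw [e]
  refine (enorm_add_le _ _).trans (add_le_add (enorm_sub_le) ?_)
  rw [intervalIntegral.integral_of_le zero_le_one]
  refine (enorm_integral_le_lintegral_enorm _).trans (le_of_eq ?_)
  refine setLIntegral_congr_fun measurableSet_Ioc fun s hs => ?_
  simp only [enorm_smul]
  rw [Real.enorm_eq_ofReal hs.1.le]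

theorem clm_apply_eq_sum {V : Type*} [NormedAddCommGroup V] [NormedSpace ℝ V] (A : E3 →L[ℝ] V)
    (z : E3) : A z = ∑ j, z j • A (EuclideanSpace.single j 1) := by
  conv_lhs => rw [← (EuclideanSpace.basisFun (Fin 3) ℝ).sum_repr z]
  simp

theorem MemW.isWeakPartial_wpd {Ω : Set E3} (hΩ : IsOpen Ω) {m : ℕ} {f : L2 Ω}
    (h : MemW (m + 1) f) (j : Fin 3) : IsWeakPartial Ω j f (wpd j f) := by
  obtain ⟨g, hg, -⟩ := h j
  rwa [hg.wpd_eq hΩ]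

theorem MemW.wpd {Ω : Set E3} (hΩ : IsOpen Ω) {m : ℕ} {f : L2 Ω}
    (h : MemW (m + 1) f) (j : Fin 3) : MemW m (wpd j f) := by
  obtain ⟨g, hg, hm⟩ := h j
  rwa [hg.wpd_eq hΩ]

/-- The norm of `W^{2,2}(Ω)`. -/
def sobNorm {Ω : Set E3} (f : L2 Ω) : ℝ :=
  ‖f‖ + ∑ j, ‖wpd j f‖ + ∑ i, ∑ j, ‖wpd i (wpd j f)‖

theorem sobNorm_nonneg {Ω : Set E3} (f : L2 Ω) : 0 ≤ sobNorm f := by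
  unfold sobNorm; positivity

theorem ofReal_sobNorm {Ω : Set E3} (f : L2 Ω) : ENNReal.ofReal (sobNorm f) =
    ‖f‖ₑ + ∑ j, ‖wpd j f‖ₑ + ∑ i, ∑ j, ‖wpd i (wpd j f)‖ₑ := by
  unfold sobNorm
  rw [ENNReal.ofReal_add (by positivity) (by positivity),
    ENNReal.ofReal_add (by positivity) (by positivity),
    ENNReal.ofReal_sum_of_nonneg fun _ _ => by positivity,
    ENNReal.ofReal_sum_of_nonneg fun _ _ => by positivity]
  simp only [ofReal_norm]
  congr 1
  refine Finset.sum_congr rfl fun i _ => ?_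
  rw [ENNReal.ofReal_sum_of_nonneg fun _ _ => by positivity]
  simp only [ofReal_norm]

theorem integrableOn_L2 {Ω : Set E3} (hb : Bornology.IsBounded Ω) (f : L2 Ω) :
    IntegrableOn f Ω volume := by
  have : IsFiniteMeasure (volume.restrict Ω) := ⟨by simpa using hb.measure_lt_top⟩
  exact (Lp.memLp f).integrable (by norm_num)

theorem hasDerivAt_moll_line {Ω : Set E3} (hΩ : IsOpen Ω) (hb : Bornology.IsBounded Ω) {f : L2 Ω}
    (h : ∀ j, IsWeakPartial Ω j f (wpd j f)) {n : ℕ} {x z : E3} {s : ℝ}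
    (hx : Metric.closedBall (x + s • z) (1 / (n + 1)) ⊆ Ω) :
    HasDerivAt (fun s : ℝ => moll n (Ω.indicator f) (x + s • z))
      (∑ j, z j • moll n (Ω.indicator (wpd j f)) (x + s • z)) s := by
  have hi := integrableOn_L2 hb f
  have hc : ContDiff ℝ ∞ (moll n (Ω.indicator f)) :=
    moll_contDiff n ((integrable_indicator_iff hΩ.measurableSet).2 hi).locallyIntegrable
  have hl : HasDerivAt (fun s : ℝ => x + s • z) z s := by
    simpa using ((hasDerivAt_id s).smul_const z).const_add x
  have := (hc.differentiable (by simp) (x + s • z)).hasFDerivAt.comp_hasDerivAt s hl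
  refine this.congr_deriv ?_
  rw [clm_apply_eq_sum]
  refine Finset.sum_congr rfl fun j _ => ?_
  rw [moll_fderiv hΩ hi (h j) hx]

theorem eLpNorm_indicator_eq_enorm {Ω : Set E3} (hΩ : IsOpen Ω) (f : L2 Ω) :
    eLpNorm (Ω.indicator f) 2 volume = ‖f‖ₑ := by
  rw [eLpNorm_indicator_eq_eLpNorm_restrict hΩ.measurableSet, Lp.enorm_def]

/-- Taylor's formula along the segments s ↦ x + s z is averaged over z in the ball at the base of
the cone. After exchanging the integrals, the second derivatives at level s cost s · s^{-3/2} =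
s^{-1/2}, which is integrable on (0,1]. -/
theorem moll_enorm_le_of_cone {Ω : Set E3} (hΩ : IsOpen Ω) (hb : Bornology.IsBounded Ω) {f : L2 Ω}
    (hf : MemW 2 f) {n : ℕ} {x e : E3} {η : ℝ}
    (hx : ∀ s ∈ Icc (0 : ℝ) 1, ∀ z ∈ Metric.closedBall e η,
      Metric.closedBall (x + s • z) (1 / (n + 1)) ⊆ Ω) :
    volume (Metric.closedBall e η) * ‖moll n (Ω.indicator f) x‖ₑ ≤
      volume (Metric.closedBall e η) ^ (1 / 2 : ℝ) *
        (‖f‖ₑ + ENNReal.ofReal (‖e‖ + η) * ∑ j, ‖wpd j f‖ₑ +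
          ENNReal.ofReal (‖e‖ + η) ^ 2 *
            (∫⁻ s in Ioc (0 : ℝ) 1, ENNReal.ofReal (s ^ (-(1 / 2) : ℝ))) *
            ∑ i, ∑ j, ‖wpd i (wpd j f)‖ₑ) := by
  have hcont : ∀ g : L2 Ω, Continuous (moll n (Ω.indicator g)) := fun g =>
    (moll_contDiff n ((integrable_indicator_iff hΩ.measurableSet).2
      (integrableOn_L2 hb g)).locallyIntegrable).continuous
  set B := Metric.closedBall e η with hB
  set R := ENNReal.ofReal (‖e‖ + η) with hR
  set F := fun g : L2 Ω => moll n (Ω.indicator g) with hF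
  have hcoord : ∀ z ∈ B, ∀ j, ‖z j‖ₑ ≤ R := by
    intro z hz j
    rw [← ofReal_norm]
    refine ENNReal.ofReal_le_ofReal ((PiLp.norm_apply_le z j).trans ?_)
    rw [hB, Metric.mem_closedBall, dist_eq_norm] at hz
    have := norm_add_le (z - e) e
    simp only [sub_add_cancel] at this
    linarith
  have hpt : ∀ z ∈ B, ‖F f x‖ₑ ≤ ‖F f (x + (1 : ℝ) • z)‖ₑ
      + R * ∑ j, ‖F (wpd j f) (x + (1 : ℝ) • z)‖ₑ
      + ∫⁻ s in Ioc (0 : ℝ) 1, ENNReal.ofReal s *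
          (R ^ 2 * ∑ i, ∑ j, ‖F (wpd i (wpd j f)) (x + s • z)‖ₑ) := by
    intro z hz
    have h0 := fun s hs => hasDerivAt_moll_line hΩ hb (hf.isWeakPartial_wpd hΩ) (hx s hs z hz)
    have h1 : ∀ s ∈ Icc (0 : ℝ) 1,
        HasDerivAt (fun s : ℝ => ∑ j, z j • F (wpd j f) (x + s • z))
          (∑ j, z j • ∑ i, z i • F (wpd i (wpd j f)) (x + s • z)) s := by
      intro s hs
      refine HasDerivAt.fun_sum fun j _ => HasDerivAt.const_smul (z j) ?_
      exact hasDerivAt_moll_line hΩ hb ((hf.wpd hΩ j).isWeakPartial_wpd hΩ) (hx s hs z hz)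
    have key := enorm_le_taylor h0 h1 (by
      have hFc : ∀ g : L2 Ω, Continuous fun s : ℝ => F g (x + s • z) := fun g =>
        (hcont g).comp (by fun_prop)
      fun_prop)
    simp only [zero_smul, add_zero] at key
    refine key.trans ?_
    gcongr with s
    · refine (enorm_sum_le _ _).trans ?_
      rw [Finset.mul_sum]
      gcongr with j
      rw [enorm_smul]
      gcongr
      exact hcoord z hz j
    · refine (enorm_sum_le _ _).trans ?_
      rw [Finset.sum_comm, Finset.mul_sum]
      gcongr with j
      rw [enorm_smul, pow_two, mul_assoc]
      refine mul_le_mul' (hcoord z hz j) ?_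
      refine (enorm_sum_le _ _).trans ?_
      rw [Finset.mul_sum]
      gcongr with i
      rw [enorm_smul]
      gcongr
      exact hcoord z hz i
  have hmeas : ∀ (g : L2 Ω) (s : ℝ), Measurable fun z : E3 => ‖F g (x + s • z)‖ₑ := fun g s =>
    ((hcont g).comp (by fun_prop : Continuous fun z : E3 => x + s • z)).measurable.enorm
  have hmeas2 : ∀ g : L2 Ω, Measurable fun q : E3 × ℝ => ‖F g (x + q.2 • q.1)‖ₑ := fun g =>
    ((hcont g).comp
      (by fun_prop : Continuous fun q : E3 × ℝ => x + q.2 • q.1)).measurable.enorm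
  have hbound : ∀ (g : L2 Ω) {s : ℝ}, 0 < s → ∫⁻ z in B, ‖F g (x + s • z)‖ₑ ≤
      volume B ^ (1 / 2 : ℝ) * (ENNReal.ofReal (s ^ (-(3 / 2) : ℝ)) * ‖g‖ₑ) := by
    intro g s hs
    rw [← eLpNorm_indicator_eq_enorm hΩ g]
    exact lintegral_moll_comp_add_smul_le
      ((Lp.stronglyMeasurable g).indicator hΩ.measurableSet) n B x hs
  have hbound1 : ∀ g : L2 Ω, ∫⁻ z in B, ‖F g (x + (1 : ℝ) • z)‖ₑ ≤
      volume B ^ (1 / 2 : ℝ) * ‖g‖ₑ := by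
    intro g
    simpa using hbound g zero_lt_one
  calc volume B * ‖F f x‖ₑ = ∫⁻ z in B, ‖F f x‖ₑ := by
        rw [lintegral_const, Measure.restrict_apply MeasurableSet.univ, univ_inter, mul_comm]
    _ ≤ ∫⁻ z in B, (‖F f (x + (1 : ℝ) • z)‖ₑ + R * ∑ j, ‖F (wpd j f) (x + (1 : ℝ) • z)‖ₑ
          + ∫⁻ s in Ioc (0 : ℝ) 1, ENNReal.ofReal s *
            (R ^ 2 * ∑ i, ∑ j, ‖F (wpd i (wpd j f)) (x + s • z)‖ₑ)) :=
        setLIntegral_mono' Metric.isClosed_closedBall.measurableSet hpt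
    _ = (∫⁻ z in B, ‖F f (x + (1 : ℝ) • z)‖ₑ)
          + R * ∑ j, (∫⁻ z in B, ‖F (wpd j f) (x + (1 : ℝ) • z)‖ₑ)
          + ∫⁻ s in Ioc (0 : ℝ) 1, ENNReal.ofReal s *
            (R ^ 2 * ∑ i, ∑ j, ∫⁻ z in B, ‖F (wpd i (wpd j f)) (x + s • z)‖ₑ) := by
        have hm1 : Measurable fun z => R * ∑ j, ‖F (wpd j f) (x + (1 : ℝ) • z)‖ₑ :=
          (Finset.measurable_fun_sum _ fun j _ => hmeas _ 1).const_mul _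
        have hm2 : Measurable fun z => ‖F f (x + (1 : ℝ) • z)‖ₑ
            + R * ∑ j, ‖F (wpd j f) (x + (1 : ℝ) • z)‖ₑ := (hmeas f 1).add hm1
        rw [lintegral_add_left hm2, lintegral_add_left (hmeas f 1),
          lintegral_const_mul _ (Finset.measurable_fun_sum _ fun j _ => hmeas _ 1),
          lintegral_finsetSum _ fun j _ => hmeas _ 1]
        congr 1
        rw [lintegral_lintegral_swap]
        · refine lintegral_congr fun s => ?_
          rw [lintegral_const_mul _ (Measurable.const_mul (Finset.measurable_fun_sum _ fun i _ =>
              Finset.measurable_fun_sum _ fun j _ => hmeas _ s) _),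
            lintegral_const_mul _ (Finset.measurable_fun_sum _ fun i _ =>
              Finset.measurable_fun_sum _ fun j _ => hmeas _ s),
            lintegral_finsetSum _ fun i _ => Finset.measurable_fun_sum _ fun j _ => hmeas _ s]
          congr 2
          refine Finset.sum_congr rfl fun i _ => ?_
          rw [lintegral_finsetSum _ fun j _ => hmeas _ s]
        · refine (Measurable.mul (by fun_prop) (Measurable.const_mul
            (Finset.measurable_fun_sum _ fun i _ =>
              Finset.measurable_fun_sum _ fun j _ => hmeas2 _) _)).aemeasurable
    _ ≤ volume B ^ (1 / 2 : ℝ) * ‖f‖ₑ + R * ∑ j, volume B ^ (1 / 2 : ℝ) * ‖wpd j f‖ₑ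
          + ∫⁻ s in Ioc (0 : ℝ) 1, ENNReal.ofReal (s ^ (-(1 / 2) : ℝ)) *
            (R ^ 2 * ∑ i, ∑ j, volume B ^ (1 / 2 : ℝ) * ‖wpd i (wpd j f)‖ₑ) := by
        refine add_le_add (add_le_add (hbound1 f) ?_) ?_
        · gcongr with j
          exact hbound1 _
        · refine setLIntegral_mono' measurableSet_Ioc fun s hs => ?_
          have e : ENNReal.ofReal (s ^ (-(1 / 2) : ℝ))
              = ENNReal.ofReal s * ENNReal.ofReal (s ^ (-(3 / 2) : ℝ)) := by
            rw [← ENNReal.ofReal_mul hs.1.le]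
            congr 1
            nth_rewrite 2 [← Real.rpow_one s]
            rw [← Real.rpow_add hs.1]
            norm_num
          rw [e, mul_assoc]
          refine mul_le_mul_right ?_ _
          rw [mul_left_comm]
          refine mul_le_mul_right ?_ _
          rw [Finset.mul_sum]
          refine Finset.sum_le_sum fun i _ => ?_
          rw [Finset.mul_sum]
          refine Finset.sum_le_sum fun j _ => ?_
          rw [mul_left_comm]
          exact hbound _ hs.1
    _ = _ := by
        rw [lintegral_mul_const _ (by fun_prop)]
        simp only [← Finset.mul_sum]
        ring

/-- The constant depends only on the shape of the cone: not on Ω, f, the vertex or the mollification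
scale. -/
theorem moll_sobolev_of_cone {e : E3} {η : ℝ} (hη : 0 < η) : ∃ C : ℝ, 0 ≤ C ∧
    ∀ {Ω : Set E3}, IsOpen Ω → Bornology.IsBounded Ω → ∀ f : L2 Ω, MemW 2 f → ∀ (n : ℕ) (x : E3),
      (∀ s ∈ Icc (0 : ℝ) 1, ∀ z ∈ Metric.closedBall e η,
        Metric.closedBall (x + s • z) (1 / (n + 1)) ⊆ Ω) →
      ‖moll n (Ω.indicator f) x‖ ≤ C * sobNorm f := by
  set v := volume (Metric.closedBall e η) with hv
  set R := ENNReal.ofReal (‖e‖ + η) with hR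
  set J := ∫⁻ s in Ioc (0 : ℝ) 1, ENNReal.ofReal (s ^ (-(1 / 2) : ℝ)) with hJ
  have hv0 : v ≠ 0 := (Metric.measure_closedBall_pos volume e hη).ne'
  have hvt : v ≠ ⊤ := measure_closedBall_lt_top.ne
  have hJt : J ≠ ⊤ := by
    have h1 := (intervalIntegrable_iff_integrableOn_Ioc_of_le zero_le_one).1
      (intervalIntegral.intervalIntegrable_rpow' (a := 0) (b := 1) (r := -(1 / 2)) (by norm_num))
    exact h1.lintegral_lt_top.ne
  set D := v⁻¹ * (v ^ (1 / 2 : ℝ) * (1 + R + R ^ 2 * J)) with hD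
  have hDt : D ≠ ⊤ := by
    refine ENNReal.mul_ne_top (ENNReal.inv_ne_top.2 hv0)
      (ENNReal.mul_ne_top (ENNReal.rpow_ne_top_of_nonneg (by norm_num) hvt) ?_)
    refine ENNReal.add_ne_top.2 ⟨ENNReal.add_ne_top.2 ⟨ENNReal.one_ne_top, ENNReal.ofReal_ne_top⟩,
      ENNReal.mul_ne_top (ENNReal.pow_ne_top ENNReal.ofReal_ne_top) hJt⟩
  refine ⟨D.toReal, ENNReal.toReal_nonneg, fun {Ω} hΩ hb f hf n x hx => ?_⟩
  have h := moll_enorm_le_of_cone hΩ hb hf hx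
  have hN := ofReal_sobNorm f
  have h2 : ‖moll n (Ω.indicator f) x‖ₑ ≤ D * ENNReal.ofReal (sobNorm f) := by
    calc ‖moll n (Ω.indicator f) x‖ₑ = v⁻¹ * (v * ‖moll n (Ω.indicator f) x‖ₑ) := by
          rw [← mul_assoc, ENNReal.inv_mul_cancel hv0 hvt, one_mul]
      _ ≤ v⁻¹ * (v ^ (1 / 2 : ℝ) * ((1 + R + R ^ 2 * J) * ENNReal.ofReal (sobNorm f))) := by
          refine mul_le_mul_right (h.trans (mul_le_mul_right ?_ _)) _
          rw [hN]
          set a := ‖f‖ₑ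
          set b := ∑ j, ‖wpd j f‖ₑ
          set c := ∑ i, ∑ j, ‖wpd i (wpd j f)‖ₑ
          calc a + R * b + R ^ 2 * J * c
              ≤ 1 * (a + b + c) + R * (a + b + c) + R ^ 2 * J * (a + b + c) := by
                rw [one_mul]
                gcongr
                · exact le_add_right (le_add_right le_rfl)
                · exact le_add_right (le_add_left le_rfl)
                · exact le_add_left le_rfl
            _ = _ := by ring
      _ = _ := by rw [hD]; ring
  rw [← toReal_enorm]
  refine (ENNReal.toReal_mono (ENNReal.mul_ne_top hDt ENNReal.ofReal_ne_top) h2).trans_eq ?_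
  rw [ENNReal.toReal_mul, ENNReal.toReal_ofReal (sobNorm_nonneg f)]

/-- The Sobolev inequality at points that are vertices of a given cone contained in `Ω`. -/
theorem sobolev_of_cone {e : E3} {η : ℝ} (hη : 0 < η) : ∃ C : ℝ, 0 ≤ C ∧
    ∀ {Ω : Set E3}, IsOpen Ω → Bornology.IsBounded Ω → ∀ f : L2 Ω, MemW 2 f →
      ∀ᵐ x ∂(volume.restrict Ω), (∀ s ∈ Icc (0 : ℝ) 1, ∀ z ∈ Metric.closedBall e η,
        x + s • z ∈ Ω) → ‖f x‖ ≤ C * sobNorm f := by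
  obtain ⟨C, hC, h⟩ := moll_sobolev_of_cone (e := e) hη
  refine ⟨C, hC, fun {Ω} hΩ hb f hf => ?_⟩
  have hi : LocallyIntegrable (Ω.indicator f) := ((integrable_indicator_iff hΩ.measurableSet).2
      (integrableOn_L2 hb f)).locallyIntegrable
  rw [ae_restrict_iff' hΩ.measurableSet]
  filter_upwards [moll_tendsto hi] with x hx hxΩ hcone
  rw [indicator_of_mem hxΩ] at hx
  have hK : IsCompact ((fun q : ℝ × E3 => x + q.1 • q.2) '' (Icc (0 : ℝ) 1 ×ˢ
      Metric.closedBall e η)) :=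
    (isCompact_Icc.prod (isCompact_closedBall e η)).image (by fun_prop)
  -- The cone is compact in the open set Ω, so there is room for all small mollification radii; the
  -- bound then passes to the limit.
  obtain ⟨δ, hδ, hδΩ⟩ := hK.exists_cthickening_subset_open hΩ (by
    rintro _ ⟨⟨s, z⟩, ⟨hs, hz⟩, rfl⟩
    exact hcone s hs z hz)
  have hsmall : ∀ᶠ n : ℕ in atTop, (1 : ℝ) / (n + 1) ≤ δ :=
    (tendsto_one_div_add_atTop_nhds_zero_nat.eventually (ge_mem_nhds hδ))
  refine le_of_tendsto hx.norm ?_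
  filter_upwards [hsmall] with n hn
  refine h hΩ hb f hf n x fun s hs z hz => ?_
  refine ((Metric.closedBall_subset_closedBall hn).trans
    (Metric.closedBall_subset_cthickening ?_ δ)).trans hδΩ
  exact ⟨(s, z), ⟨hs, hz⟩, rfl⟩

/-- Near an interior point a small ball serves as the cone. Near a boundary point the defining
function ρ strictly decreases in all directions close to a fixed e₁, so short segments in these
directions cannot leave {ρ < 0}. -/
theorem IsSmoothBoundedDomain.exists_cone {Ω : Set E3} (h : IsSmoothBoundedDomain Ω) {x₀ : E3}
    (hx₀ : x₀ ∈ closure Ω) : ∃ U ∈ 𝓝 x₀, ∃ (e : E3) (η : ℝ), 0 < η ∧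
      ∀ x ∈ U ∩ Ω, ∀ s ∈ Icc (0 : ℝ) 1, ∀ z ∈ Metric.closedBall e η, x + s • z ∈ Ω := by
  by_cases hin : x₀ ∈ Ω
  · obtain ⟨r, hr, hball⟩ := Metric.isOpen_iff.1 h.isOpen x₀ hin
    refine ⟨Metric.ball x₀ (r / 2), Metric.ball_mem_nhds _ (by positivity), 0, r / 3,
      by positivity, fun x hx s hs z hz => hball ?_⟩
    rw [mem_closedBall_zero_iff] at hz
    have h1 := hx.1
    rw [Metric.mem_ball, dist_eq_norm] at h1 ⊢
    calc ‖x + s • z - x₀‖ = ‖(x - x₀) + s • z‖ := by congr 1; abel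
      _ ≤ ‖x - x₀‖ + ‖s • z‖ := norm_add_le _ _
      _ < r := by
        rw [norm_smul, Real.norm_of_nonneg hs.1]
        have : s * ‖z‖ ≤ 1 * (r / 3) := mul_le_mul hs.2 hz (norm_nonneg _) zero_le_one
        linarith
  · have hfr : x₀ ∈ frontier Ω := ⟨hx₀, fun hi => hin (interior_subset hi)⟩
    obtain ⟨N, ρ, hN, hxN, hρ, hdρ, hΩN⟩ := h.smooth_boundary x₀ hfr
    obtain ⟨e₁, he₁⟩ : ∃ e₁, fderiv ℝ ρ x₀ e₁ < 0 := by
      by_contra! hcon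
      apply hdρ
      ext y
      have h1 := hcon y
      have h2 := hcon (-y)
      rw [map_neg] at h2
      simp only [zero_apply]
      linarith
    have hcont : Continuous fun q : E3 × E3 => fderiv ℝ ρ q.1 q.2 :=
      ((hρ.continuous_fderiv (by simp)).comp continuous_fst).clm_apply continuous_snd
    have hev : ∀ᶠ q : E3 × E3 in 𝓝 (x₀, e₁), fderiv ℝ ρ q.1 q.2 < 0 ∧ q.1 ∈ N :=
      (hcont.continuousAt.eventually_lt continuousAt_const he₁).and
        (continuous_fst.continuousAt.eventually (hN.mem_nhds hxN))
    obtain ⟨r, hr, hrsub⟩ := Metric.eventually_nhds_iff.1 hev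
    have hneg : ∀ x z, dist x x₀ < r → dist z e₁ < r → fderiv ℝ ρ x z < 0 ∧ x ∈ N := by
      intro x z hx hz
      have hd : dist (x, z) (x₀, e₁) < r := Prod.dist_eq.trans_lt (max_lt hx hz)
      exact hrsub hd
    -- Chosen so that c(‖e₁‖ + r) = r/2: segments that start within r/2 of x₀ stay within r of it.
    set c := r / (2 * (‖e₁‖ + r)) with hc
    have hden : 0 < ‖e₁‖ + r := by positivity
    have hc0 : 0 < c := by positivity
    refine ⟨Metric.ball x₀ (r / 2), Metric.ball_mem_nhds _ (by positivity), c • e₁, c * (r / 2),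
      by positivity, fun x hx s hs z hz => ?_⟩
    obtain ⟨z', rfl⟩ : ∃ z', z = c • z' := ⟨c⁻¹ • z, by rw [smul_inv_smul₀ hc0.ne']⟩
    have hz' : dist z' e₁ ≤ r / 2 := by
      rw [Metric.mem_closedBall, dist_smul₀, Real.norm_of_nonneg hc0.le] at hz
      exact le_of_mul_le_mul_left hz hc0
    have hz'n : ‖z'‖ < ‖e₁‖ + r := by
      have := norm_add_le (z' - e₁) e₁
      rw [sub_add_cancel, ← dist_eq_norm] at this
      linarith
    have hpath : ∀ a ∈ Icc (0 : ℝ) 1, dist (x + a • c • z') x₀ < r := by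
      intro a ha
      have h1 := hx.1
      rw [Metric.mem_ball, dist_eq_norm] at h1
      rw [dist_eq_norm]
      have h3 : c * ‖z'‖ ≤ r / 2 := by
        calc c * ‖z'‖ ≤ c * (‖e₁‖ + r) := by gcongr
          _ = r / 2 := by rw [hc]; field_simp
      calc ‖x + a • c • z' - x₀‖ = ‖(x - x₀) + a • c • z'‖ := by congr 1; abel
        _ ≤ ‖x - x₀‖ + ‖a • c • z'‖ := norm_add_le _ _
        _ < r := by
          rw [norm_smul, norm_smul, Real.norm_of_nonneg ha.1, Real.norm_of_nonneg hc0.le]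
          have : a * (c * ‖z'‖) ≤ 1 * (c * ‖z'‖) := by
            gcongr
            exact ha.2
          linarith
    have hmem : ∀ y, y ∈ N → (y ∈ Ω ↔ ρ y < 0) := by
      intro y hy
      have := Set.ext_iff.1 hΩN y
      simpa [hy] using this
    have hz'r : dist z' e₁ < r := by linarith
    have hp0 := hpath 0 ⟨le_rfl, zero_le_one⟩
    simp only [zero_smul, add_zero] at hp0
    have hx0 : ρ x < 0 := (hmem x (hneg x z' hp0 hz'r).2).1 hx.2
    have hder : ∀ a : ℝ, HasDerivAt (fun a : ℝ => ρ (x + a • c • z'))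
        (fderiv ℝ ρ (x + a • c • z') (c • z')) a := by
      intro a
      have hl : HasDerivAt (fun a : ℝ => x + a • c • z') (c • z') a := by
        simpa using ((hasDerivAt_id a).smul_const (c • z')).const_add x
      exact (hρ.differentiable (by simp) _).hasFDerivAt.comp_hasDerivAt a hl
    have hanti : AntitoneOn (fun a : ℝ => ρ (x + a • c • z')) (Icc 0 1) := by
      refine antitoneOn_of_deriv_nonpos (convex_Icc 0 1)
        (fun a _ => (hder a).continuousAt.continuousWithinAt)
        (fun a _ => (hder a).differentiableAt.differentiableWithinAt) fun a ha => ?_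
      rw [interior_Icc] at ha
      rw [(hder a).deriv, map_smul, smul_eq_mul]
      exact (mul_neg_of_pos_of_neg hc0
        (hneg _ z' (hpath a ⟨ha.1.le, ha.2.le⟩) hz'r).1).le
    have := hanti ⟨le_rfl, zero_le_one⟩ hs hs.1
    simp only [zero_smul, add_zero] at this
    exact (hmem _ (hneg _ z' (hpath s hs) hz'r).2).2 (this.trans_lt hx0)

/-- The Sobolev embedding `W^{2,2}(Ω) ⊆ L^∞(Ω)` in a smooth bounded domain of `ℝ³`. -/
theorem IsSmoothBoundedDomain.sobolev {Ω : Set E3} (h : IsSmoothBoundedDomain Ω) :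
    ∃ C : ℝ, 0 ≤ C ∧ ∀ f : L2 Ω, MemW 2 f →
      ∀ᵐ x ∂(volume.restrict Ω), ‖f x‖ ≤ C * sobNorm f := by
  have hK : IsCompact (closure Ω) := h.isBounded.isCompact_closure
  have key : ∃ C : ℝ, 0 ≤ C ∧ ∀ f : L2 Ω, MemW 2 f →
      ∀ᵐ x ∂(volume.restrict Ω), x ∈ closure Ω → ‖f x‖ ≤ C * sobNorm f := by
    -- Compactness of the closure reduces the claim to finitely many cones; on a union of two sets
    -- the sum of the constants works.
    refine hK.induction_on (p := fun S => ∃ C : ℝ, 0 ≤ C ∧ ∀ f : L2 Ω, MemW 2 f →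
      ∀ᵐ x ∂(volume.restrict Ω), x ∈ S → ‖f x‖ ≤ C * sobNorm f) ?_ ?_ ?_ ?_
    · exact ⟨0, le_rfl, fun f _ => by simp⟩
    · rintro S S' hSS' ⟨C, hC, hS'⟩
      refine ⟨C, hC, fun f hf => ?_⟩
      filter_upwards [hS' f hf] with x hx hxS using hx (hSS' hxS)
    · rintro S S' ⟨C, hC, hS⟩ ⟨C', hC', hS'⟩
      refine ⟨C + C', add_nonneg hC hC', fun f hf => ?_⟩
      filter_upwards [hS f hf, hS' f hf] with x hx hx' hxS
      have := sobNorm_nonneg f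
      have := mul_nonneg hC this
      have := mul_nonneg hC' (sobNorm_nonneg f)
      rw [add_mul]
      rcases hxS with hxS | hxS
      · linarith [hx hxS]
      · linarith [hx' hxS]
    · intro x₀ hx₀
      obtain ⟨U, hU, e, η, hη, hcone⟩ := h.exists_cone hx₀
      obtain ⟨C, hC, hs⟩ := sobolev_of_cone (e := e) hη
      refine ⟨U, mem_nhdsWithin_of_mem_nhds hU, C, hC, fun f hf => ?_⟩
      filter_upwards [hs h.isOpen h.isBounded f hf, ae_restrict_mem h.isOpen.measurableSet]
        with x hx hxΩ hxU
      exact hx (hcone x ⟨hxU, hxΩ⟩)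
  obtain ⟨C, hC, hs⟩ := key
  refine ⟨C, hC, fun f hf => ?_⟩
  filter_upwards [hs f hf, ae_restrict_mem h.isOpen.measurableSet] with x hx hxΩ
  exact hx (subset_closure hxΩ)

end Sobolev

/-! ### Absolutely continuous curves, Grönwall, and passage from almost all times to all times -/

section Time

/-- Telescoping over a fine equal subdivision of [0,t] gives |Q t - Q 0| ≤ ε(Γ t - Γ 0), and then ε
tends to 0. -/
theorem eq_of_increment_le {Q Γ : ℝ → ℝ} {T : ℝ}
    (h : ∀ ε > 0, ∃ δ > 0, ∀ s ∈ Icc 0 T, ∀ t ∈ Icc 0 T, s ≤ t → t - s < δ →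
      |Q t - Q s| ≤ ε * (Γ t - Γ s)) {t : ℝ} (ht : t ∈ Icc 0 T) : Q t = Q 0 := by
  have hT : 0 ≤ T := ht.1.trans ht.2
  have key : ∀ ε > 0, |Q t - Q 0| ≤ ε * (Γ t - Γ 0) := by
    intro ε hε
    obtain ⟨δ, hδ, hs⟩ := h ε hε
    obtain ⟨N, hN⟩ := exists_nat_gt (t / δ)
    have hN0 : (0 : ℝ) < N + 1 := by positivity
    have hstep : t / (N + 1) < δ := by
      rw [div_lt_iff₀ hδ] at hN
      rw [div_lt_iff₀ hN0]
      nlinarith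
    have ht0 : 0 ≤ t / (N + 1) := div_nonneg ht.1 hN0.le
    have hind : ∀ i : ℕ, i ≤ N + 1 →
        |Q (i * (t / (N + 1))) - Q 0| ≤ ε * (Γ (i * (t / (N + 1))) - Γ 0) := by
      intro i
      induction i with
      | zero => simp
      | succ i ih =>
        intro hi
        have h1 := ih (by omega)
        have hmem : ∀ k : ℕ, k ≤ N + 1 → (k : ℝ) * (t / (N + 1)) ∈ Icc 0 T := by
          intro k hk
          refine ⟨by positivity, ?_⟩
          have hk' : (k : ℝ) ≤ N + 1 := by exact_mod_cast hk
          calc (k : ℝ) * (t / (N + 1)) ≤ (N + 1) * (t / (N + 1)) := by gcongr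
            _ = t := by field_simp
            _ ≤ T := ht.2
        have h2 := hs _ (hmem i (by omega)) _ (hmem (i + 1) hi)
          (by push_cast; nlinarith) (by push_cast; linarith)
        calc |Q (((i + 1 : ℕ) : ℝ) * (t / (N + 1))) - Q 0|
            ≤ |Q (((i + 1 : ℕ) : ℝ) * (t / (N + 1))) - Q (i * (t / (N + 1)))|
              + |Q (i * (t / (N + 1))) - Q 0| := abs_sub_le _ _ _
          _ ≤ _ := by linarith
    have h3 := hind (N + 1) le_rfl
    have h4 : ((N + 1 : ℕ) : ℝ) * (t / (N + 1)) = t := by push_cast; field_simp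
    rwa [h4] at h3
  have h0 : |Q t - Q 0| ≤ 0 := by
    have hl : Tendsto (fun ε : ℝ => ε * (Γ t - Γ 0)) (𝓝[>] 0) (𝓝 (0 * (Γ t - Γ 0))) :=
      (tendsto_id.mul_const _).mono_left nhdsWithin_le_nhds
    rw [zero_mul] at hl
    exact ge_of_tendsto hl (eventually_nhdsWithin_of_forall key)
  exact sub_eq_zero.1 (abs_nonpos_iff.1 h0)

theorem intervalIntegrable_of_mem_Icc {V : Type*} [NormedAddCommGroup V] {F : ℝ → V} {T : ℝ}
    (hF : IntegrableOn F (Icc 0 T))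
    {s t : ℝ} (hs : s ∈ Icc 0 T) (ht : t ∈ Icc 0 T) : IntervalIntegrable F volume s t := by
  rw [intervalIntegrable_iff]
  refine hF.mono_set (uIoc_subset_uIcc.trans ?_)
  exact (convex_Icc 0 T).ordConnected.uIcc_subset hs ht

/-! ### Chain rule in a Hilbert space -/

section Hilbert

variable {H : Type*} [NormedAddCommGroup H] [InnerProductSpace ℝ H]

theorem integrableOn_inner {F X : ℝ → H} {T : ℝ} (hF : IntegrableOn F (Icc 0 T))
    (hX : ContinuousOn X (Icc 0 T)) : IntegrableOn (fun r => inner ℝ (F r) (X r)) (Icc 0 T) := by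
  obtain ⟨M, hM⟩ := isCompact_Icc.exists_bound_of_continuousOn hX
  refine Integrable.mono' (g := fun r => ‖F r‖ * M) (hF.norm.mul_const M)
    (hF.aestronglyMeasurable.inner (hX.aestronglyMeasurable measurableSet_Icc)) ?_
  filter_upwards [ae_restrict_mem measurableSet_Icc] with r hr
  refine (norm_inner_le_norm _ _).trans ?_
  gcongr
  exact hM r hr

/-- The increment of F is the integral of F', and on a short interval X t s differs from X r r by
less than ε, by uniform continuity on the compact square. -/
theorem inner_increment_sub_integral_le [CompleteSpace H] {F F' : ℝ → H} {X : ℝ → ℝ → H} {T : ℝ}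
    (hF' : IntegrableOn F' (Icc 0 T)) (hF : ∀ t ∈ Icc 0 T, F t = F 0 + ∫ r in (0 : ℝ)..t, F' r)
    (hX : ContinuousOn (fun q : ℝ × ℝ => X q.1 q.2) (Icc 0 T ×ˢ Icc 0 T)) :
    ∀ ε > 0, ∃ δ > 0, ∀ s ∈ Icc 0 T, ∀ t ∈ Icc 0 T, s ≤ t → t - s < δ →
      |inner ℝ (F t - F s) (X t s) - ∫ r in s..t, inner ℝ (F' r) (X r r)|
        ≤ ε * ∫ r in s..t, ‖F' r‖ := by
  intro ε hε
  have hu := (isCompact_Icc.prod isCompact_Icc).uniformContinuousOn_of_continuous hX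
  rw [Metric.uniformContinuousOn_iff] at hu
  obtain ⟨δ, hδ, hu⟩ := hu ε hε
  refine ⟨δ, hδ, fun s hs t ht hst hlt => ?_⟩
  have h0 : (0 : ℝ) ∈ Icc 0 T := ⟨le_rfl, hs.1.trans hs.2⟩
  have hi := intervalIntegrable_of_mem_Icc hF' hs ht
  have hdiag : ContinuousOn (fun r => X r r) (Icc 0 T) :=
    hX.comp (f := fun r : ℝ => (r, r)) (by fun_prop) fun r hr => ⟨hr, hr⟩
  have hii : IntervalIntegrable (fun r => inner ℝ (F' r) (X r r)) volume s t :=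
    intervalIntegrable_of_mem_Icc (integrableOn_inner hF' hdiag) hs ht
  have hic : IntervalIntegrable (fun r => inner ℝ (F' r) (X t s)) volume s t :=
    intervalIntegrable_of_mem_Icc (integrableOn_inner hF' continuousOn_const) hs ht
  have e1 : F t - F s = ∫ r in s..t, F' r := by
    rw [hF t ht, hF s hs, ← intervalIntegral.integral_interval_sub_left
      (intervalIntegrable_of_mem_Icc hF' h0 ht) (intervalIntegrable_of_mem_Icc hF' h0 hs)]
    abel
  have e2 : inner ℝ (∫ r in s..t, F' r) (X t s) = ∫ r in s..t, inner ℝ (F' r) (X t s) := by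
    rw [real_inner_comm]
    have := (innerSL ℝ (X t s)).intervalIntegral_comp_comm hi
    simp only [innerSL_apply_apply] at this
    rw [← this]
    simp only [real_inner_comm]
  rw [e1, e2, ← intervalIntegral.integral_sub hic hii, ← intervalIntegral.integral_const_mul,
    ← Real.norm_eq_abs]
  refine intervalIntegral.norm_integral_le_of_norm_le hst ?_ (hi.norm.const_mul ε)
  refine Eventually.of_forall fun r hr => ?_
  rw [← inner_sub_right]
  refine (norm_inner_le_norm _ _).trans ?_
  rw [mul_comm]
  refine mul_le_mul_of_nonneg_right ?_ (norm_nonneg _)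
  have hrT : r ∈ Icc 0 T := ⟨hs.1.trans hr.1.le, hr.2.trans ht.2⟩
  have := hu (t, s) ⟨ht, hs⟩ (r, r) ⟨hrT, hrT⟩ (by
    refine Prod.dist_eq.trans_lt (max_lt ?_ ?_)
    · rw [Real.dist_eq, abs_of_nonneg (by linarith [hr.2])]
      linarith [hr.1]
    · rw [Real.dist_eq, abs_sub_comm, abs_of_nonneg (by linarith [hr.1])]
      linarith [hr.2])
  rw [dist_eq_norm] at this
  exact this.le

/-- A chain rule for absolutely continuous curves in a Hilbert space. -/
theorem sub_eq_integral_of_increment_eq [CompleteSpace H] {F F' K K' : ℝ → H}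
    {X Y : ℝ → ℝ → H} {T : ℝ} {E : ℝ → ℝ}
    (hF' : IntegrableOn F' (Icc 0 T)) (hF : ∀ t ∈ Icc 0 T, F t = F 0 + ∫ r in (0 : ℝ)..t, F' r)
    (hK' : IntegrableOn K' (Icc 0 T)) (hK : ∀ t ∈ Icc 0 T, K t = K 0 + ∫ r in (0 : ℝ)..t, K' r)
    (hX : ContinuousOn (fun q : ℝ × ℝ => X q.1 q.2) (Icc 0 T ×ˢ Icc 0 T))
    (hY : ContinuousOn (fun q : ℝ × ℝ => Y q.1 q.2) (Icc 0 T ×ˢ Icc 0 T))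
    (hE : ∀ s ∈ Icc 0 T, ∀ t ∈ Icc 0 T,
      E t - E s = inner ℝ (F t - F s) (X t s) + inner ℝ (K t - K s) (Y t s)) :
    IntegrableOn (fun r => inner ℝ (F' r) (X r r) + inner ℝ (K' r) (Y r r)) (Icc 0 T) ∧
    ∀ t ∈ Icc 0 T,
      E t - E 0 = ∫ r in (0 : ℝ)..t, (inner ℝ (F' r) (X r r) + inner ℝ (K' r) (Y r r)) := by
  have hXd : ContinuousOn (fun r => X r r) (Icc 0 T) :=
    hX.comp (f := fun r : ℝ => (r, r)) (by fun_prop) fun r hr => ⟨hr, hr⟩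
  have hYd : ContinuousOn (fun r => Y r r) (Icc 0 T) :=
    hY.comp (f := fun r : ℝ => (r, r)) (by fun_prop) fun r hr => ⟨hr, hr⟩
  have hi1 := integrableOn_inner hF' hXd
  have hi2 := integrableOn_inner hK' hYd
  refine ⟨hi1.add hi2, fun t ht => ?_⟩
  have h0 : (0 : ℝ) ∈ Icc 0 T := ⟨le_rfl, ht.1.trans ht.2⟩
  set p := fun r => inner ℝ (F' r) (X r r) + inner ℝ (K' r) (Y r r) with hp
  have hpi : IntegrableOn p (Icc 0 T) := hi1.add hi2
  -- The defect between E and its candidate primitive has increments at most ε times those of the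
  -- total variation bound Γ, hence is constant.
  have key := eq_of_increment_le (T := T) (Q := fun t => E t - ∫ r in (0 : ℝ)..t, p r)
    (Γ := fun t => (∫ r in (0 : ℝ)..t, ‖F' r‖) + ∫ r in (0 : ℝ)..t, ‖K' r‖) ?_ ht
  · simp only [intervalIntegral.integral_same, sub_zero] at key
    linarith
  · intro ε hε
    obtain ⟨δ₁, hδ₁, h1⟩ := inner_increment_sub_integral_le hF' hF hX ε hε
    obtain ⟨δ₂, hδ₂, h2⟩ := inner_increment_sub_integral_le hK' hK hY ε hε
    refine ⟨min δ₁ δ₂, lt_min hδ₁ hδ₂, fun s hs t ht hst hlt => ?_⟩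
    have g1 := h1 s hs t ht hst (hlt.trans_le (min_le_left _ _))
    have g2 := h2 s hs t ht hst (hlt.trans_le (min_le_right _ _))
    have e1 := intervalIntegral.integral_interval_sub_left
      (intervalIntegrable_of_mem_Icc hpi h0 ht) (intervalIntegrable_of_mem_Icc hpi h0 hs)
    have e2 := intervalIntegral.integral_interval_sub_left
      (intervalIntegrable_of_mem_Icc hF'.norm h0 ht) (intervalIntegrable_of_mem_Icc hF'.norm h0 hs)
    have e3 := intervalIntegral.integral_interval_sub_left
      (intervalIntegrable_of_mem_Icc hK'.norm h0 ht) (intervalIntegrable_of_mem_Icc hK'.norm h0 hs)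
    have e4 : ∫ r in s..t, p r = _ := intervalIntegral.integral_add
      (intervalIntegrable_of_mem_Icc hi1 hs ht) (intervalIntegrable_of_mem_Icc hi2 hs ht)
    have e5 := hE s hs t ht
    calc |(E t - ∫ r in (0 : ℝ)..t, p r) - (E s - ∫ r in (0 : ℝ)..s, p r)|
        = |(inner ℝ (F t - F s) (X t s) - ∫ r in s..t, inner ℝ (F' r) (X r r))
          + (inner ℝ (K t - K s) (Y t s) - ∫ r in s..t, inner ℝ (K' r) (Y r r))| := by
          congr 1
          linarith
      _ ≤ _ := abs_add_le _ _
      _ ≤ ε * (∫ r in s..t, ‖F' r‖) + ε * ∫ r in s..t, ‖K' r‖ := add_le_add g1 g2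
      _ = _ := by rw [← e2, ← e3]; ring

end Hilbert

/-- Grönwall is applied to the primitive of E, which is differentiable from the right and starts at
0, rather than to E itself. -/
theorem eq_zero_of_le_integral {E : ℝ → ℝ} {T C : ℝ} (hE : ContinuousOn E (Icc 0 T))
    (h0 : ∀ t ∈ Icc 0 T, 0 ≤ E t) (h : ∀ t ∈ Icc 0 T, E t ≤ C * ∫ r in (0 : ℝ)..t, E r)
    {t : ℝ} (ht : t ∈ Icc 0 T) : E t = 0 := by
  have hT : (0 : ℝ) ∈ Icc 0 T := ⟨le_rfl, ht.1.trans ht.2⟩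
  have hi : IntegrableOn E (Icc 0 T) := hE.integrableOn_Icc
  have hderiv : ∀ x ∈ Ico 0 T, HasDerivWithinAt (fun t => ∫ r in (0 : ℝ)..t, E r) (E x)
      (Ici x) x := by
    intro x hx
    have hxT : x ∈ Icc 0 T := ⟨hx.1, hx.2.le⟩
    have hc : ContinuousWithinAt E (Ioi x) x :=
      (hE x hxT).mono_of_mem_nhdsWithin (mem_of_superset (Ioc_mem_nhdsGT hx.2)
        fun y hy => ⟨hx.1.trans hy.1.le, hy.2⟩)
    refine intervalIntegral.integral_hasDerivWithinAt_right
      (intervalIntegrable_of_mem_Icc hi hT hxT) (s := Ici x) (t := Ioi x) ?_ hc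
    refine ⟨Ioc x T, Ioc_mem_nhdsGT hx.2, ?_⟩
    exact (hi.mono_set fun y hy => ⟨hx.1.trans hy.1.le, hy.2⟩).aestronglyMeasurable
  have hnn : ∀ t ∈ Icc 0 T, 0 ≤ ∫ r in (0 : ℝ)..t, E r := fun t ht =>
    intervalIntegral.integral_nonneg ht.1 fun r hr => h0 r ⟨hr.1, hr.2.trans ht.2⟩
  have hgr := norm_le_gronwallBound_of_norm_deriv_right_le (δ := 0) (K := C) (ε := 0)
    (f := fun t => ∫ r in (0 : ℝ)..t, E r) (f' := E) (a := 0) (b := T)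
    (by
      have := intervalIntegral.continuousOn_primitive_interval (a := 0) (b := T) (f := E)
        (μ := volume) (by rwa [uIcc_of_le hT.2])
      rwa [uIcc_of_le hT.2] at this)
    hderiv (by simp) (by
      intro x hx
      have hxT : x ∈ Icc 0 T := ⟨hx.1, hx.2.le⟩
      rw [Real.norm_of_nonneg (h0 x hxT), Real.norm_of_nonneg (hnn x hxT), add_zero]
      exact h x hxT) t ht
  simp only [gronwallBound_ε0_δ0] at hgr
  have h1 := norm_le_zero_iff.1 hgr
  have h2 := h t ht
  rw [h1, mul_zero] at h2
  exact le_antisymm h2 (h0 t ht)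

theorem HasTimeDeriv.continuousOn {Ω : Set E3} {T : ℝ} (hT : 0 ≤ T) {f g : ℝ → L2 Ω}
    (h : HasTimeDeriv T f g) : ContinuousOn f (Icc 0 T) := by
  have := intervalIntegral.continuousOn_primitive_interval (a := 0) (b := T) (f := g)
    (μ := volume) (by rw [uIcc_of_le hT]; exact h.1)
  rw [uIcc_of_le hT] at this
  exact (continuousOn_const.add this).congr h.2

/-- By Lebesgue differentiation. It identifies the time derivative of u behind v₁ with the one in
the Landau–Lifshitz equation. -/
theorem HasTimeDeriv.unique {Ω : Set E3} {T : ℝ} {f g g' : ℝ → L2 Ω}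
    (h : HasTimeDeriv T f g) (h' : HasTimeDeriv T f g') :
    ∀ᵐ t ∂(volume.restrict (Icc 0 T)), g t = g' t := by
  rcases lt_or_ge T 0 with hT | hT
  · simp [Icc_eq_empty hT.not_ge]
  have h0 : (0 : ℝ) ∈ Icc 0 T := ⟨le_rfl, hT⟩
  have hTT : T ∈ Icc 0 T := ⟨hT, le_rfl⟩
  have hi : IntegrableOn (fun t => g t - g' t) (Icc 0 T) := h.1.sub h'.1
  have hz : ∀ t ∈ Icc 0 T, ∫ s in (0 : ℝ)..t, (g s - g' s) = 0 := by
    intro t ht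
    rw [intervalIntegral.integral_sub (intervalIntegrable_of_mem_Icc h.1 h0 ht)
      (intervalIntegrable_of_mem_Icc h'.1 h0 ht), sub_eq_zero]
    exact add_left_cancel ((h.2 t ht).symm.trans (h'.2 t ht))
  have hd := (intervalIntegrable_of_mem_Icc hi h0 hTT).ae_hasDerivAt_integral
  rw [← restrict_Ioo_eq_restrict_Icc, ae_restrict_iff' measurableSet_Ioo]
  filter_upwards [hd] with t hdt ht
  have htm : t ∈ uIcc 0 T := by rw [uIcc_of_le hT]; exact Ioo_subset_Icc_self ht
  have h1 := hdt htm 0 left_mem_uIcc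
  have h2 : HasDerivAt (fun x => ∫ s in (0 : ℝ)..x, (g s - g' s)) 0 t := by
    refine (hasDerivAt_const t (0 : L2 Ω)).congr_of_eventuallyEq ?_
    filter_upwards [isOpen_Ioo.mem_nhds ht] with x hx using hz x (Ioo_subset_Icc_self hx)
  exact sub_eq_zero.1 (h1.unique h2)

/-- The distance from F to S is continuous in time and vanishes almost everywhere, hence everywhere.
-/
theorem forall_mem_Icc_of_ae_mem {X : Type*} [PseudoMetricSpace X] {S : Set X} (hS : IsClosed S)
    {T : ℝ} (hT : 0 < T) {F : ℝ → X} (hF : ContinuousOn F (Icc 0 T))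
    (h : ∀ᵐ t ∂(volume.restrict (Icc 0 T)), F t ∈ S) : ∀ t ∈ Icc 0 T, F t ∈ S := by
  have hne : S.Nonempty := by
    have : NeZero (volume.restrict (Icc 0 T)) := ⟨by
      rw [Ne, Measure.restrict_eq_zero, Real.volume_Icc]
      simpa using hT⟩
    obtain ⟨t, ht⟩ := h.exists
    exact ⟨_, ht⟩
  have key := Measure.eqOn_Icc_of_ae_eq volume (a := 0) (b := T) hT.ne
    (f := fun t => Metric.infDist (F t) S) (g := fun _ => 0) (by
      filter_upwards [h] with t ht using Metric.infDist_zero_of_mem ht)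
    ((Metric.continuous_infDist_pt S).comp_continuousOn hF) continuousOn_const
  intro t ht
  rw [hS.mem_iff_infDist_zero hne]
  exact key ht

/-- Convergence in L² yields almost everywhere convergence along a subsequence, extracted first for
one component and then, within it, for the other. -/
theorem isClosed_setOf_ae_mem {Ω : Set E3} {C : Set (E3 × E3)} (hC : IsClosed C) :
    IsClosed {q : L2 Ω × L2 Ω | ∀ᵐ x ∂(volume.restrict Ω), (q.1 x, q.2 x) ∈ C} := by
  refine IsSeqClosed.isClosed fun q p hq hp => ?_
  have h1 : Tendsto (fun n => (q n).1) atTop (𝓝 p.1) := (continuous_fst.tendsto p).comp hp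
  have h2 : Tendsto (fun n => (q n).2) atTop (𝓝 p.2) := (continuous_snd.tendsto p).comp hp
  obtain ⟨ns, hns, hlim⟩ := (tendstoInMeasure_of_tendsto_Lp h1).exists_seq_tendsto_ae
  obtain ⟨ms, hms, hlim'⟩ := (tendstoInMeasure_of_tendsto_Lp
    (h2.comp hns.tendsto_atTop)).exists_seq_tendsto_ae
  have hall : ∀ᵐ x ∂(volume.restrict Ω), ∀ n, ((q n).1 x, (q n).2 x) ∈ C := ae_all_iff.2 hq
  filter_upwards [hlim, hlim', hall] with x hx hx' hxall
  refine hC.mem_of_tendsto ((hx.comp hms.tendsto_atTop).prodMk_nhds hx') ?_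
  exact Eventually.of_forall fun n => hxall _

/-- A closed pointwise relation that holds at almost all times holds at all times. -/
theorem forall_ae_of_ae_ae {Ω : Set E3} {P : E3 → E3 → Prop}
    (hP : IsClosed {q : E3 × E3 | P q.1 q.2}) {T : ℝ} (hT : 0 < T) {a b : ℝ → L2 Ω}
    (ha : ContinuousOn a (Icc 0 T)) (hb : ContinuousOn b (Icc 0 T))
    (h : ∀ᵐ t ∂(volume.restrict (Icc 0 T)), ∀ᵐ x ∂(volume.restrict Ω), P (a t x) (b t x)) :
    ∀ t ∈ Icc 0 T, ∀ᵐ x ∂(volume.restrict Ω), P (a t x) (b t x) :=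
  forall_mem_Icc_of_ae_mem (F := fun t => (a t, b t)) (isClosed_setOf_ae_mem hP) hT
    (ha.prodMk hb) h

end Time

/-! ### The product ⟨a,b⟩c on bounded sets of L² -/

section Trilinear

variable {Ω : Set E3}

theorem dot_comm (a b : E3) : dot a b = dot b a := real_inner_comm _ _

theorem abs_dot_le (a b : E3) : |dot a b| ≤ ‖a‖ * ‖b‖ := abs_real_inner_le_norm a b

theorem dot_cross_self (a b : E3) : dot (cross a b) a = 0 := by
  simp only [dot, cross, EuclideanSpace.inner_eq_star_dotProduct, star_trivial]
  exact dot_self_cross _ _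

theorem aestronglyMeasurable_dot_smul (a b c : L2 Ω) :
    AEStronglyMeasurable (fun x => dot (a x) (b x) • c x) (volume.restrict Ω) :=
  AEStronglyMeasurable.fun_smul
    ((Lp.aestronglyMeasurable a).inner (𝕜 := ℝ) (Lp.aestronglyMeasurable b))
    (Lp.aestronglyMeasurable c)

/-- The trilinear expression `⟨a,b⟩c`. -/
def mul3 (a b c : L2 Ω) : L2 Ω := ofFun Ω fun x => dot (a x) (b x) • c x

theorem ofFun_ae {g : E3 → E3} (hg : MemLp g 2 (volume.restrict Ω)) :
    ofFun Ω g =ᵐ[volume.restrict Ω] g := by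
  rw [ofFun, dif_pos hg]
  exact hg.coeFn_toLp

theorem norm_dot_smul_le {M : ℝ} {p q r : E3} (hp : ‖p‖ ≤ M) (hq : ‖q‖ ≤ M) :
    ‖dot p q • r‖ ≤ M ^ 2 * ‖r‖ := by
  rw [norm_smul, Real.norm_eq_abs]
  refine mul_le_mul_of_nonneg_right ((abs_dot_le p q).trans ?_) (norm_nonneg _)
  rw [pow_two]
  have := (norm_nonneg _).trans hp
  gcongr

theorem mul3_ae {M : ℝ} {a b c : L2 Ω} (ha : ∀ᵐ x ∂(volume.restrict Ω), ‖a x‖ ≤ M)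
    (hb : ∀ᵐ x ∂(volume.restrict Ω), ‖b x‖ ≤ M) :
    mul3 a b c =ᵐ[volume.restrict Ω] fun x => dot (a x) (b x) • c x := by
  refine ofFun_ae ((Lp.memLp c).of_le_mul (c := M ^ 2) (aestronglyMeasurable_dot_smul a b c) ?_)
  filter_upwards [ha, hb] with x h1 h2 using norm_dot_smul_le h1 h2

/-- One factor is changed at a time; the changed factor is measured in L² and the other two in L^∞.
This makes the product continuous for the L² topology on uniformly bounded families. -/
theorem mul3_sub_le {M : ℝ} {a b c a' b' c' : L2 Ω}
    (ha : ∀ᵐ x ∂(volume.restrict Ω), ‖a x‖ ≤ M) (hb : ∀ᵐ x ∂(volume.restrict Ω), ‖b x‖ ≤ M)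
    (hc : ∀ᵐ x ∂(volume.restrict Ω), ‖c x‖ ≤ M) (ha' : ∀ᵐ x ∂(volume.restrict Ω), ‖a' x‖ ≤ M)
    (hb' : ∀ᵐ x ∂(volume.restrict Ω), ‖b' x‖ ≤ M) :
    ‖mul3 a b c - mul3 a' b' c'‖ ≤ M ^ 2 * (‖a - a'‖ + ‖b - b'‖ + ‖c - c'‖) := by
  have h1 : ‖mul3 a b c - mul3 a' b c‖ ≤ M ^ 2 * ‖a - a'‖ := by
    refine Lp.norm_le_mul_norm_of_ae_le_mul ?_
    filter_upwards [Lp.coeFn_sub (mul3 a b c) (mul3 a' b c), Lp.coeFn_sub a a',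
      mul3_ae (c := c) ha hb, mul3_ae (c := c) ha' hb, hb, hc] with x e1 e2 e3 e4 hb hc
    rw [e1, e2]
    simp only [Pi.sub_apply, e3, e4]
    rw [← sub_smul, dot, dot, ← inner_sub_left, norm_smul]
    calc ‖inner ℝ (a x - a' x) (b x)‖ * ‖c x‖ ≤ ‖a x - a' x‖ * ‖b x‖ * ‖c x‖ := by
          gcongr
          exact norm_inner_le_norm _ _
      _ ≤ ‖a x - a' x‖ * M * M := by
          have := (norm_nonneg _).trans hc
          gcongr
      _ = _ := by ring
  have h2 : ‖mul3 a' b c - mul3 a' b' c‖ ≤ M ^ 2 * ‖b - b'‖ := by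
    refine Lp.norm_le_mul_norm_of_ae_le_mul ?_
    filter_upwards [Lp.coeFn_sub (mul3 a' b c) (mul3 a' b' c), Lp.coeFn_sub b b',
      mul3_ae (c := c) ha' hb, mul3_ae (c := c) ha' hb', ha', hc] with x e1 e2 e3 e4 ha hc
    rw [e1, e2]
    simp only [Pi.sub_apply, e3, e4]
    rw [← sub_smul, dot, dot, ← inner_sub_right, norm_smul]
    calc ‖inner ℝ (a' x) (b x - b' x)‖ * ‖c x‖ ≤ ‖a' x‖ * ‖b x - b' x‖ * ‖c x‖ := by
          gcongr
          exact norm_inner_le_norm _ _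
      _ ≤ M * ‖b x - b' x‖ * M := by
          have := (norm_nonneg _).trans hc
          gcongr
      _ = _ := by ring
  have h3 : ‖mul3 a' b' c - mul3 a' b' c'‖ ≤ M ^ 2 * ‖c - c'‖ := by
    refine Lp.norm_le_mul_norm_of_ae_le_mul ?_
    filter_upwards [Lp.coeFn_sub (mul3 a' b' c) (mul3 a' b' c'), Lp.coeFn_sub c c',
      mul3_ae (c := c) ha' hb', mul3_ae (c := c') ha' hb', ha', hb'] with x e1 e2 e3 e4 ha hb
    rw [e1, e2]
    simp only [Pi.sub_apply, e3, e4]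
    rw [← smul_sub]
    exact norm_dot_smul_le ha hb
  calc ‖mul3 a b c - mul3 a' b' c'‖
      = ‖(mul3 a b c - mul3 a' b c) + (mul3 a' b c - mul3 a' b' c)
          + (mul3 a' b' c - mul3 a' b' c')‖ := by congr 1; abel
    _ ≤ _ := norm_add₃_le
    _ ≤ _ := by linarith

theorem continuousOn_mul3 {X : Type*} [TopologicalSpace X] {S : Set X} {M : ℝ} {a b c : X → L2 Ω}
    (ha : ContinuousOn a S) (hb : ContinuousOn b S) (hc : ContinuousOn c S)
    (hA : ∀ q ∈ S, ∀ᵐ x ∂(volume.restrict Ω), ‖a q x‖ ≤ M)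
    (hB : ∀ q ∈ S, ∀ᵐ x ∂(volume.restrict Ω), ‖b q x‖ ≤ M)
    (hC : ∀ q ∈ S, ∀ᵐ x ∂(volume.restrict Ω), ‖c q x‖ ≤ M) :
    ContinuousOn (fun q => mul3 (a q) (b q) (c q)) S := by
  intro q hq
  rw [ContinuousWithinAt, tendsto_iff_norm_sub_tendsto_zero]
  have hl : Tendsto (fun r => M ^ 2 * (‖a r - a q‖ + ‖b r - b q‖ + ‖c r - c q‖)) (𝓝[S] q)
      (𝓝 (M ^ 2 * (0 + 0 + 0))) :=
    (((tendsto_iff_norm_sub_tendsto_zero.1 (ha q hq)).add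
      (tendsto_iff_norm_sub_tendsto_zero.1 (hb q hq))).add
      (tendsto_iff_norm_sub_tendsto_zero.1 (hc q hq))).const_mul _
  simp only [add_zero, mul_zero] at hl
  refine squeeze_zero' (Eventually.of_forall fun _ => norm_nonneg _) ?_ hl
  filter_upwards [self_mem_nhdsWithin] with r hr
  exact mul3_sub_le (hA r hr) (hB r hr) (hC r hr) (hA q hq) (hB q hq)

theorem inner_mul3 {M : ℝ} {a b : L2 Ω} (c d : L2 Ω)
    (ha : ∀ᵐ x ∂(volume.restrict Ω), ‖a x‖ ≤ M) (hb : ∀ᵐ x ∂(volume.restrict Ω), ‖b x‖ ≤ M) :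
    inner ℝ d (mul3 a b c) = ∫ x in Ω, dot (a x) (b x) * dot (c x) (d x) := by
  rw [L2.inner_def]
  refine integral_congr_ae ?_
  filter_upwards [mul3_ae (c := c) ha hb] with x hx
  rw [hx, inner_smul_right, dot_comm (c x)]
  rfl

theorem integrable_dot (a b : L2 Ω) :
    Integrable (fun x => dot (a x) (b x)) (volume.restrict Ω) :=
  L2.integrable_inner a b

end Trilinear

/-! ### Spatial calculus at a fixed time -/

section Spatial

variable {Ω : Set E3}

theorem EssBdd.of_L2 {f : L2 Ω} {M : ℝ} (h : ∀ᵐ x ∂(volume.restrict Ω), ‖f x‖ ≤ M) :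
    EssBdd Ω f := ⟨Lp.aestronglyMeasurable f, M, h⟩

/-- A function on the sphere is orthogonal to its weak derivatives. -/
theorem dot_wpd_eq_zero (hΩ : IsOpen Ω) (hb : Bornology.IsBounded Ω) {u : L2 Ω} {j : Fin 3}
    (hu : ∀ᵐ x ∂(volume.restrict Ω), ‖u x‖ = 1) (hd : EssBdd Ω (wpd j u))
    (hw : IsWeakPartial Ω j u (wpd j u)) :
    ∀ᵐ x ∂(volume.restrict Ω), dot (wpd j u x) (u x) = 0 := by
  have hub : EssBdd Ω u := EssBdd.of_L2 (M := 1) (hu.mono fun x hx => hx.le)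
  have hB := WeakPartial.bilin hΩ hb (innerSL ℝ : E3 →L[ℝ] E3 →L[ℝ] ℝ) hub hd hub hd hw hw
  have hloc : IntegrableOn (fun x => dot (wpd j u x) (u x)) Ω := integrable_dot _ _
  have key := hΩ.ae_eq_zero_of_integral_contDiff_smul_eq_zero (μ := volume)
    hloc.locallyIntegrableOn (by
      intro φ hφ hc hs
      have h1 := hB φ hφ hc hs
      have h2 : ∫ x in Ω, (fderiv ℝ φ x (EuclideanSpace.single j 1)) •
          innerSL ℝ (u x) (u x) = 0 := by
        have hc' : HasCompactSupport fun x => fderiv ℝ φ x (EuclideanSpace.single j 1) :=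
          hc.fderiv_apply ℝ _
        have hφd : Continuous fun x => fderiv ℝ φ x (EuclideanSpace.single j 1) :=
          (hφ.continuous_fderiv (by simp)).clm_apply continuous_const
        have e1 : ∫ x in Ω, (fderiv ℝ φ x (EuclideanSpace.single j 1)) • innerSL ℝ (u x) (u x)
            = ∫ x in Ω, fderiv ℝ φ x (EuclideanSpace.single j 1) := by
          refine integral_congr_ae ?_
          filter_upwards [hu] with x hx
          simp [innerSL_apply_apply, hx]
        -- Since |u|² = 1, the left side of the Leibniz identity is the integral of a derivative of
        -- φ, which vanishes by parts against the constant 1.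
        have e2 := integral_mul_fderiv_eq_neg_fderiv_mul_of_integrable (μ := volume)
          (f := fun _ : E3 => (1 : ℝ)) (g := φ) (v := EuclideanSpace.single j 1)
          (by simp) (by simpa using hφd.integrable_of_hasCompactSupport hc')
          (by simpa using hφ.continuous.integrable_of_hasCompactSupport hc)
          (fun x _ => differentiableAt_const _) (fun x _ => hφ.differentiable (by simp) x)
        rw [e1, setIntegral_eq_integral_of_forall_compl_eq_zero]
        · simpa using e2
        · intro x hx
          rw [image_eq_zero_of_notMem_tsupport (f := fderiv ℝ φ)
            fun h => hx (hs (tsupport_fderiv_subset ℝ h))]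
          simp
      rw [h2] at h1
      have h3 : ∫ x in Ω, φ x • dot (wpd j u x) (u x) = 0 := by
        have e : ∀ x, φ x • (innerSL ℝ (wpd j u x) (u x) + innerSL ℝ (u x) (wpd j u x))
            = 2 * (φ x • dot (wpd j u x) (u x)) := by
          intro x
          simp only [innerSL_apply_apply, smul_eq_mul, real_inner_comm, dot]
          ring
        simp only [e, integral_const_mul] at h1
        linarith
      rw [← h3]
      refine (setIntegral_eq_integral_of_forall_compl_eq_zero fun x hx => ?_).symm
      rw [image_eq_zero_of_notMem_tsupport fun h => hx (hs h), zero_smul])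
  rwa [ae_restrict_iff' hΩ.measurableSet]

/-- `ofFun` of the Leibniz expression is the weak derivative of `⟨a,b⟩c`. -/
theorem isWeakPartial_mul3 (hΩ : IsOpen Ω) (hb : Bornology.IsBounded Ω) {a b c a' b' c' : L2 Ω}
    {j : Fin 3} (ha : EssBdd Ω a) (ha' : EssBdd Ω a') (hb₁ : EssBdd Ω b) (hb' : EssBdd Ω b')
    (hc : EssBdd Ω c) (hc' : EssBdd Ω c') (hwa : IsWeakPartial Ω j a a')
    (hwb : IsWeakPartial Ω j b b') (hwc : IsWeakPartial Ω j c c') :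
    ∃ g : L2 Ω, IsWeakPartial Ω j (mul3 a b c) g ∧ g =ᵐ[volume.restrict Ω] fun x =>
      (dot (a' x) (b x) + dot (a x) (b' x)) • c x + dot (a x) (b x) • c' x := by
  have h1 := WeakPartial.bilin hΩ hb (innerSL ℝ : E3 →L[ℝ] E3 →L[ℝ] ℝ) ha ha' hb₁ hb' hwa hwb
  have e1 := ha.bilin (innerSL ℝ : E3 →L[ℝ] E3 →L[ℝ] ℝ) hb₁
  have e2 := (ha'.bilin (innerSL ℝ : E3 →L[ℝ] E3 →L[ℝ] ℝ) hb₁).add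
    (ha.bilin (innerSL ℝ : E3 →L[ℝ] E3 →L[ℝ] ℝ) hb')
  have h2 := WeakPartial.bilin hΩ hb (lsmul ℝ ℝ : ℝ →L[ℝ] E3 →L[ℝ] E3) e1 e2 hc hc' h1 hwc
  have e3 := (e2.bilin (lsmul ℝ ℝ : ℝ →L[ℝ] E3 →L[ℝ] E3) hc).add
    (e1.bilin (lsmul ℝ ℝ : ℝ →L[ℝ] E3 →L[ℝ] E3) hc')
  have m3 := e3.memLp hb 2
  have m1 := (e1.bilin (lsmul ℝ ℝ : ℝ →L[ℝ] E3 →L[ℝ] E3) hc).memLp hb 2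
  have hm : mul3 a b c =ᵐ[volume.restrict Ω] fun x => dot (a x) (b x) • c x := ofFun_ae m1
  refine ⟨m3.toLp _, ?_, m3.coeFn_toLp⟩
  intro φ hφ hcs hs
  refine (integral_congr_ae (hm.mono fun x hx => ?_)).trans ((h2 φ hφ hcs hs).trans
    (congrArg Neg.neg (integral_congr_ae (m3.coeFn_toLp.mono fun x hx => ?_))))
  · exact congrArg (fderiv ℝ φ x (EuclideanSpace.single j 1) • ·) hx
  · exact congrArg (φ x • ·) hx.symm

theorem EssBdd.dot {f g : E3 → E3} (hf : EssBdd Ω f) (hg : EssBdd Ω g) :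
    EssBdd Ω fun x => LLFlow.dot (f x) (g x) :=
  hf.bilin (innerSL ℝ : E3 →L[ℝ] E3 →L[ℝ] ℝ) hg

theorem EssBdd.mul {f g : E3 → ℝ} (hf : EssBdd Ω f) (hg : EssBdd Ω g) :
    EssBdd Ω fun x => f x * g x :=
  hf.bilin (ContinuousLinearMap.mul ℝ ℝ) hg

theorem energyDensity_eq (u : L2 Ω) (x : E3) :
    energyDensity u x = ∑ j, dot (wpd j u x) (wpd j u x) := by
  simp [energyDensity, dot]

/-- The energy inequality for `h = ⟨w,u⟩`, where `w` and `u` satisfy the Neumann condition. -/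
theorem energy_inequality (hΩ : IsOpen Ω) (hb : Bornology.IsBounded Ω) {u w : L2 Ω} {M : ℝ}
    (hu : EssBdd Ω u) (hw : EssBdd Ω w) (hdu : ∀ j, EssBdd Ω (wpd j u))
    (hdw : ∀ j, EssBdd Ω (wpd j w)) (hwu : ∀ j, IsWeakPartial Ω j u (wpd j u))
    (hww : ∀ j, IsWeakPartial Ω j w (wpd j w)) (hNu : NeumannZero u) (hNw : NeumannZero w)
    (hM : ∀ j, ∀ᵐ x ∂(volume.restrict Ω), ‖wpd j u x‖ ≤ M) :
    ∫ x in Ω, dot (w x) (u x) * (dot (wlap w x) (u x) + 2 * ∑ j, dot (wpd j u x) (wpd j w x)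
        + dot (wlap u x) (w x) + energyDensity u x * dot (w x) (u x))
      ≤ 3 * M ^ 2 * ∫ x in Ω, dot (w x) (u x) * dot (w x) (u x) := by
  have hh := hw.dot hu
  choose g₁ hg₁ hg₁e using fun j => isWeakPartial_mul3 hΩ hb hw (hdw j) hu (hdu j) hu (hdu j)
    (hww j) (hwu j) (hwu j)
  choose g₂ hg₂ hg₂e using fun j => isWeakPartial_mul3 hΩ hb hw (hdw j) hu (hdu j) hw (hdw j)
    (hww j) (hwu j) (hww j)
  have hφ₁ : mul3 w u u =ᵐ[volume.restrict Ω] fun x => dot (w x) (u x) • u x :=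
    ofFun_ae ((hh.bilin (lsmul ℝ ℝ : ℝ →L[ℝ] E3 →L[ℝ] E3) hu).memLp hb 2)
  have hφ₂ : mul3 w u w =ᵐ[volume.restrict Ω] fun x => dot (w x) (u x) • w x :=
    ofFun_ae ((hh.bilin (lsmul ℝ ℝ : ℝ →L[ℝ] E3 →L[ℝ] E3) hw).memLp hb 2)
  -- With h = ⟨w,u⟩, testing Δw with hu and Δu with hw produces the two Laplacian terms of hΔh.
  have n₁ := hNw (mul3 w u u) fun j => ⟨g₁ j, hg₁ j, trivial⟩
  have n₂ := hNu (mul3 w u w) fun j => ⟨g₂ j, hg₂ j, trivial⟩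
  simp only [(hg₁ _).wpd_eq hΩ] at n₁
  simp only [(hg₂ _).wpd_eq hΩ] at n₂
  have hP : Integrable (fun x => dot (w x) (u x) * (2 * ∑ j, dot (wpd j u x) (wpd j w x)
      + energyDensity u x * dot (w x) (u x))) (volume.restrict Ω) := by
    have e1 : EssBdd Ω fun x => ∑ j, dot (wpd j u x) (wpd j w x) :=
      EssBdd.sum _ fun j _ => (hdu j).dot (hdw j)
    have e2 : EssBdd Ω fun x => energyDensity u x := by
      simp only [energyDensity_eq]
      exact EssBdd.sum _ fun j _ => (hdu j).dot (hdu j)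
    have e3 : EssBdd Ω fun _ => (2 : ℝ) :=
      ⟨aestronglyMeasurable_const, 2, Eventually.of_forall fun _ => by norm_num⟩
    exact (hh.mul ((e3.mul e1).add (e2.mul hh))).integrableOn hb
  have hS₁ : Integrable (fun x => ∑ j, dot (wpd j w x) (g₁ j x)) (volume.restrict Ω) :=
    integrable_finsetSum _ fun j _ => integrable_dot _ _
  have hS₂ : Integrable (fun x => ∑ j, dot (wpd j u x) (g₂ j x)) (volume.restrict Ω) :=
    integrable_finsetSum _ fun j _ => integrable_dot _ _
  have hL₁ := integrable_dot (wlap w) (mul3 w u u)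
  have hL₂ := integrable_dot (wlap u) (mul3 w u w)
  have hhh : Integrable (fun x => dot (w x) (u x) * dot (w x) (u x)) (volume.restrict Ω) :=
    (hh.mul hh).integrableOn hb
  calc ∫ x in Ω, dot (w x) (u x) * (dot (wlap w x) (u x)
          + 2 * ∑ j, dot (wpd j u x) (wpd j w x)
          + dot (wlap u x) (w x) + energyDensity u x * dot (w x) (u x))
      = ∫ x in Ω, (dot (wlap w x) (mul3 w u u x) + dot (wlap u x) (mul3 w u w x)
          + dot (w x) (u x) * (2 * ∑ j, dot (wpd j u x) (wpd j w x)
            + energyDensity u x * dot (w x) (u x))) := by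
        refine integral_congr_ae ?_
        filter_upwards [hφ₁, hφ₂] with x h1 h2
        rw [h1, h2]
        simp only [dot, inner_smul_right]
        ring
    _ = -(∫ x in Ω, ∑ j, dot (wpd j w x) (g₁ j x)) + -(∫ x in Ω, ∑ j, dot (wpd j u x) (g₂ j x))
          + ∫ x in Ω, dot (w x) (u x) * (2 * ∑ j, dot (wpd j u x) (wpd j w x)
            + energyDensity u x * dot (w x) (u x)) := by
        rw [integral_add (hL₁.fun_add hL₂) hP, integral_add hL₁ hL₂, n₁, n₂]
    _ = ∫ x in Ω, (-(∑ j, dot (wpd j w x) (g₁ j x)) + -(∑ j, dot (wpd j u x) (g₂ j x))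
          + dot (w x) (u x) * (2 * ∑ j, dot (wpd j u x) (wpd j w x)
            + energyDensity u x * dot (w x) (u x))) := by
        rw [integral_add (hS₁.fun_neg.fun_add hS₂.fun_neg) hP, integral_add hS₁.fun_neg hS₂.fun_neg,
          integral_neg, integral_neg]
    _ ≤ ∫ x in Ω, 3 * M ^ 2 * (dot (w x) (u x) * dot (w x) (u x)) := by
        refine integral_mono_ae ((hS₁.fun_neg.fun_add hS₂.fun_neg).fun_add hP) (hhh.const_mul _) ?_
        filter_upwards [ae_all_iff.2 hg₁e, ae_all_iff.2 hg₂e, ae_all_iff.2 hM] with x h1 h2 h3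
        have he : energyDensity u x ≤ 3 * M ^ 2 := by
          calc energyDensity u x ≤ ∑ _j : Fin 3, M ^ 2 :=
                Finset.sum_le_sum fun j _ => pow_le_pow_left₀ (norm_nonneg _) (h3 j) 2
            _ = 3 * M ^ 2 := by simp
        -- The terms in which h is not differentiated cancel against 2h⟨∂u,∂w⟩; the rest is -∑(∂_j
        -- h)².
        have hsum : -(∑ j, dot (wpd j w x) (g₁ j x)) + -(∑ j, dot (wpd j u x) (g₂ j x))
            + dot (w x) (u x) * (2 * ∑ j, dot (wpd j u x) (wpd j w x))
            = -∑ j, (dot (wpd j w x) (u x) + dot (w x) (wpd j u x)) ^ 2 := by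
          rw [← Finset.sum_neg_distrib, ← Finset.sum_neg_distrib, ← Finset.sum_neg_distrib,
            Finset.mul_sum, Finset.mul_sum, ← Finset.sum_add_distrib, ← Finset.sum_add_distrib]
          refine Finset.sum_congr rfl fun j _ => ?_
          rw [h1 j, h2 j]
          simp only [dot, inner_add_right, inner_smul_right]
          rw [real_inner_comm (wpd j w x) (wpd j u x), real_inner_comm (w x) (wpd j u x)]
          ring
        have hpos : 0 ≤ ∑ j, (dot (wpd j w x) (u x) + dot (w x) (wpd j u x)) ^ 2 :=
          Finset.sum_nonneg fun j _ => sq_nonneg _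
        have := mul_le_mul_of_nonneg_right he (mul_self_nonneg (dot (w x) (u x)))
        linarith [mul_add (dot (w x) (u x)) (2 * ∑ j, dot (wpd j u x) (wpd j w x))
          (energyDensity u x * dot (w x) (u x))]
    _ = _ := integral_const_mul _ _

end Spatial

/-! ### Tangency of the remainder and the equation of ⟨w,u⟩ -/

section Geometry

variable {Ω : Set E3}

theorem tangProj_ae {u : L2 Ω} (hu : ∀ᵐ x ∂(volume.restrict Ω), ‖u x‖ = 1) (f : L2 Ω) :
    tangProj u f =ᵐ[volume.restrict Ω] fun x => f x - dot (f x) (u x) • u x := by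
  refine ofFun_ae ((Lp.memLp f).sub ((Lp.memLp f).of_le_mul (c := 1)
    (aestronglyMeasurable_dot_smul f u u) ?_))
  filter_upwards [hu] with x hx
  rw [norm_smul, hx, mul_one, one_mul, Real.norm_eq_abs]
  simpa [hx] using abs_dot_le (f x) (u x)

theorem dot_tangProj {u : L2 Ω} (hu : ∀ᵐ x ∂(volume.restrict Ω), ‖u x‖ = 1) (f : L2 Ω) :
    ∀ᵐ x ∂(volume.restrict Ω), dot (tangProj u f x) (u x) = 0 := by
  filter_upwards [tangProj_ae hu f, hu] with x hx h1
  rw [hx]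
  simp only [dot, inner_sub_left, inner_smul_left, real_inner_self_eq_norm_sq, h1]
  simp

/-- The covariant derivatives are projections, and the curvature term is a combination of v and ∂_j
u, all orthogonal to u. -/
theorem dot_remainder {u v θ : L2 Ω} (hu : ∀ᵐ x ∂(volume.restrict Ω), ‖u x‖ = 1)
    (hdu : ∀ j, ∀ᵐ x ∂(volume.restrict Ω), dot (wpd j u x) (u x) = 0)
    (hv : ∀ᵐ x ∂(volume.restrict Ω), dot (v x) (u x) = 0)
    (hθ : ∀ᵐ x ∂(volume.restrict Ω), dot (θ x) (u x) = 0) :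
    ∀ᵐ x ∂(volume.restrict Ω), dot (remainder u v θ x) (u x) = 0 := by
  have hc : ∀ j, ∀ᵐ x ∂(volume.restrict Ω),
      dot (covPartial u j (covPartial u j v) x) (u x) = 0 := fun j => dot_tangProj hu _
  filter_upwards [ae_all_iff.2 hdu, hv, hθ, ae_all_iff.2 hc] with x h1 h2 h3 h4
  simp only [dot] at h1 h2 h3 h4
  simp only [remainder, curvS2, dot, inner_sub_left, sum_inner, inner_smul_left, h1, h2, h3, h4]
  simp

/-- The equation of `⟨w,u⟩`, if `w` solves the approximate problem. -/
theorem dot_time_deriv {u u' w w' v₁ : L2 Ω} {R : E3 → E3} {ε : ℝ}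
    (hu : ∀ᵐ x ∂(volume.restrict Ω), ‖u x‖ = 1)
    (hu' : ∀ᵐ x ∂(volume.restrict Ω), u' x = cross (u x) (wlap u x))
    (hv₁ : v₁ = tangProj u u') (hR : ∀ᵐ x ∂(volume.restrict Ω), dot (R x) (u x) = 0)
    (hw : ∀ᵐ x ∂(volume.restrict Ω), w' x + dot (w x) (v₁ x) • u x =
        ε • (wlap w x + (2 * ∑ j, dot (wpd j u x) (wpd j w x)) • u x
              + dot (wlap u x) (w x) • u x + energyDensity u x • w x)
          + cross (u x) (wlap w x + energyDensity u x • w x)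
          + (ε • R x + cross (u x) (R x))) :
    ∀ᵐ x ∂(volume.restrict Ω), dot (u x) (w' x) + dot (w x) (u' x) =
      ε * (dot (wlap w x) (u x) + 2 * ∑ j, dot (wpd j u x) (wpd j w x)
        + dot (wlap u x) (w x) + energyDensity u x * dot (w x) (u x)) := by
  filter_upwards [hu, hu', hR, hw, tangProj_ae hu u'] with x h1 h2 h3 h4 h5
  rw [← hv₁] at h5
  -- The velocity is already tangent, so v₁ equals u' pointwise.
  have h6 : dot (u' x) (u x) = 0 := by rw [h2]; exact dot_cross_self _ _
  rw [h6, zero_smul, sub_zero] at h5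
  rw [h5] at h4
  have huu : inner ℝ (u x) (u x) = (1 : ℝ) := by rw [real_inner_self_eq_norm_sq, h1]; norm_num
  have h7 := congrArg (fun y => dot y (u x)) h4
  have c1 := dot_cross_self (u x) (wlap w x + energyDensity u x • w x)
  have c2 := dot_cross_self (u x) (R x)
  simp only [dot] at h3 h7 c1 c2 ⊢
  simp only [inner_add_left, inner_smul_left, huu, c1, c2, h3, RCLike.conj_to_real] at h7
  rw [real_inner_comm (w' x) (u x)]
  linarith

end Geometry

/-! ### Uniform bounds and the energy argument in time -/

section Energy

variable {Ω : Set E3}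

theorem MemW.mono {m n : ℕ} (h : m ≤ n) {f : L2 Ω} (hf : MemW n f) : MemW m f := by
  induction m generalizing n f with
  | zero => trivial
  | succ m ih =>
    obtain ⟨n, rfl⟩ : ∃ n', n = n' + 1 := ⟨n - 1, by omega⟩
    intro j
    obtain ⟨g, hg, hgm⟩ := hf j
    exact ⟨g, hg, ih (by omega) hgm⟩

theorem MemC0W.exists_bound (hΩ : IsSmoothBoundedDomain Ω) {T : ℝ} {w : ℝ → L2 Ω}
    (hw : MemC0W T 2 w) :
    ∃ M : ℝ, ∀ t ∈ Icc 0 T, ∀ᵐ x ∂(volume.restrict Ω), ‖w t x‖ ≤ M := by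
  obtain ⟨C, hC, hs⟩ := hΩ.sobolev
  have hcont : ContinuousOn (fun t => sobNorm (w t)) (Icc 0 T) := by
    refine ((hw.2 [] (by simp)).norm.add
      (continuousOn_finsetSum _ fun j _ => (hw.2 [j] (by simp)).norm)).add
      (continuousOn_finsetSum _ fun i _ => continuousOn_finsetSum _ fun j _ =>
        (hw.2 [i, j] (by simp)).norm)
  obtain ⟨N, hN⟩ := isCompact_Icc.exists_bound_of_continuousOn hcont
  refine ⟨C * N, fun t ht => ?_⟩
  filter_upwards [hs (w t) (hw.1 t ht)] with x hx
  refine hx.trans (mul_le_mul_of_nonneg_left ((le_abs_self _).trans (hN t ht)) hC)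

theorem MemLp.ae_norm_le_of_top {α V : Type*} [MeasurableSpace α] [NormedAddCommGroup V]
    {μ : Measure α} {f : α → V} (hf : MemLp f ⊤ μ) : ∃ N : ℝ, ∀ᵐ t ∂μ, ‖f t‖ ≤ N := by
  refine ⟨(eLpNorm f ⊤ μ).toReal, ?_⟩
  filter_upwards [ae_le_eLpNormEssSup (f := f) (μ := μ)] with t ht
  rw [← toReal_enorm]
  refine ENNReal.toReal_mono hf.2.ne ?_
  rwa [eLpNorm_exponent_top]

theorem MemLpW.exists_bound_wpd (hΩ : IsSmoothBoundedDomain Ω) {T : ℝ} {m : ℕ} (hm : 3 ≤ m)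
    {u : ℝ → L2 Ω} (hu : MemLpW T ⊤ m u) :
    ∃ M : ℝ, ∀ᵐ t ∂(volume.restrict (Icc 0 T)), ∀ j,
      ∀ᵐ x ∂(volume.restrict Ω), ‖wpd j (u t) x‖ ≤ M := by
  obtain ⟨C, hC, hs⟩ := hΩ.sobolev
  -- The length condition sits under the existential so that `choose` gives a bound for every list;
  -- the values on longer lists are never used.
  have hb : ∀ l : List (Fin 3), ∃ N : ℝ, l.length ≤ m →
      ∀ᵐ t ∂(volume.restrict (Icc 0 T)), ‖wpds l (u t)‖ ≤ N := by
    intro l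
    by_cases hl : l.length ≤ m
    · obtain ⟨N, hN⟩ := MemLp.ae_norm_le_of_top (hu.2 l hl)
      exact ⟨N, fun _ => hN⟩
    · exact ⟨0, fun h => absurd h hl⟩
  choose N hN using hb
  set K : Fin 3 → ℝ := fun j => N [j] + ∑ i, N [i, j] + ∑ i, ∑ l, N [i, l, j] with hK
  have hsob : ∀ᵐ t ∂(volume.restrict (Icc 0 T)), ∀ j, sobNorm (wpd j (u t)) ≤ K j := by
    have a1 := ae_all_iff.2 fun j => hN [j] (by simp; omega)
    have a2 := ae_all_iff.2 fun i => ae_all_iff.2 fun j => hN [i, j] (by simp; omega)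
    have a3 := ae_all_iff.2 fun i => ae_all_iff.2 fun l => ae_all_iff.2 fun j =>
      hN [i, l, j] (by simp; omega)
    filter_upwards [a1, a2, a3] with t h1 h2 h3 j
    exact add_le_add (add_le_add (h1 j) (Finset.sum_le_sum fun i _ => h2 i j))
      (Finset.sum_le_sum fun i _ => Finset.sum_le_sum fun l _ => h3 i l j)
  refine ⟨C * ∑ j, |K j|, ?_⟩
  filter_upwards [hsob, hu.1] with t h1 h2 j
  filter_upwards [hs _ ((h2.mono hm).wpd hΩ.isOpen j)] with x hx
  refine hx.trans (mul_le_mul_of_nonneg_left ?_ hC)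
  exact ((h1 j).trans (le_abs_self _)).trans
    (Finset.single_le_sum (f := fun j => |K j|) (fun _ _ => abs_nonneg _) (Finset.mem_univ j))

/-- The energy `∫ ⟨w,u⟩²`. -/
def pairEnergy (w u : L2 Ω) : ℝ := inner ℝ w (mul3 w u u)

theorem pairEnergy_eq {M : ℝ} {w u : L2 Ω} (hw : ∀ᵐ x ∂(volume.restrict Ω), ‖w x‖ ≤ M)
    (hu : ∀ᵐ x ∂(volume.restrict Ω), ‖u x‖ ≤ M) :
    pairEnergy w u = ∫ x in Ω, dot (w x) (u x) * dot (w x) (u x) := by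
  rw [pairEnergy, inner_mul3 _ _ hw hu]
  simp only [dot_comm (u _)]

theorem pairEnergy_eq_zero {M : ℝ} {w u : L2 Ω} (hw : ∀ᵐ x ∂(volume.restrict Ω), ‖w x‖ ≤ M)
    (hu : ∀ᵐ x ∂(volume.restrict Ω), ‖u x‖ ≤ M) (hb : Bornology.IsBounded Ω)
    (h : pairEnergy w u = 0) : ∀ᵐ x ∂(volume.restrict Ω), dot (w x) (u x) = 0 := by
  rw [pairEnergy_eq hw hu] at h
  have hh := (EssBdd.of_L2 hw).dot (EssBdd.of_L2 hu)
  have := (integral_eq_zero_iff_of_nonneg (fun x => mul_self_nonneg _)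
    ((hh.mul hh).integrableOn hb)).1 h
  filter_upwards [this] with x hx
  exact mul_self_eq_zero.1 hx

/-- With h = ⟨w,u⟩ and h₀ = ⟨w₀,u₀⟩, this is h² - h₀² = (h + h₀)(⟨w - w₀,u⟩ + ⟨w₀,u - u₀⟩),
integrated. Each increment enters only as the left factor of a pairing, as the chain rule requires.
-/
theorem pairEnergy_sub {M : ℝ} {w u w₀ u₀ : L2 Ω}
    (hw : ∀ᵐ x ∂(volume.restrict Ω), ‖w x‖ ≤ M) (hu : ∀ᵐ x ∂(volume.restrict Ω), ‖u x‖ ≤ M)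
    (hw₀ : ∀ᵐ x ∂(volume.restrict Ω), ‖w₀ x‖ ≤ M) (hu₀ : ∀ᵐ x ∂(volume.restrict Ω), ‖u₀ x‖ ≤ M) :
    pairEnergy w u - pairEnergy w₀ u₀ =
      inner ℝ (w - w₀) (mul3 w u u + mul3 w₀ u₀ u)
        + inner ℝ (u - u₀) (mul3 w u w₀ + mul3 w₀ u₀ w₀) := by
  have s1 : inner ℝ w₀ (mul3 w u u) = inner ℝ u (mul3 w u w₀) := by
    rw [inner_mul3 _ _ hw hu, inner_mul3 _ _ hw hu]
    simp only [dot_comm (u _)]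
  have s2 : inner ℝ w (mul3 w₀ u₀ u) = inner ℝ u₀ (mul3 w u w₀) := by
    rw [inner_mul3 _ _ hw₀ hu₀, inner_mul3 _ _ hw hu]
    simp only [dot_comm (u _), mul_comm]
  have s3 : inner ℝ w₀ (mul3 w₀ u₀ u) = inner ℝ u (mul3 w₀ u₀ w₀) := by
    rw [inner_mul3 _ _ hw₀ hu₀, inner_mul3 _ _ hw₀ hu₀]
    simp only [dot_comm (u _)]
  have s4 : inner ℝ w₀ (mul3 w₀ u₀ u₀) = inner ℝ u₀ (mul3 w₀ u₀ w₀) := by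
    rw [inner_mul3 _ _ hw₀ hu₀, inner_mul3 _ _ hw₀ hu₀]
    simp only [dot_comm (u₀ _)]
  simp only [pairEnergy, inner_sub_left, inner_add_right]
  linarith

theorem energy_rate_eq {M : ℝ} {w u w' u' : L2 Ω} (hw : ∀ᵐ x ∂(volume.restrict Ω), ‖w x‖ ≤ M)
    (hu : ∀ᵐ x ∂(volume.restrict Ω), ‖u x‖ ≤ M) :
    inner ℝ w' (mul3 w u u + mul3 w u u) + inner ℝ u' (mul3 w u w + mul3 w u w) =
      2 * ∫ x in Ω, dot (w x) (u x) * (dot (u x) (w' x) + dot (w x) (u' x)) := by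
  have hi : ∀ c d : L2 Ω, Integrable (fun x => dot (w x) (u x) * dot (c x) (d x))
      (volume.restrict Ω) := by
    intro c d
    refine (integrable_dot (mul3 w u c) d).congr ?_
    filter_upwards [mul3_ae (c := c) hw hu] with x hx
    rw [hx]
    simp only [dot, inner_smul_left, RCLike.conj_to_real]
  simp only [mul_add]
  rw [inner_add_right, inner_add_right, inner_mul3 _ _ hw hu, inner_mul3 _ _ hw hu,
    integral_add (hi _ _) (hi _ _)]
  ring

/-- Uniqueness for the linear parabolic equation satisfied by `⟨w,u⟩`, by the energy method. -/
theorem dot_eq_zero_of_energy (hb : Bornology.IsBounded Ω) {T C M : ℝ} {w u w' u' : ℝ → L2 Ω}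
    (hwt : HasTimeDeriv T w w') (hut : HasTimeDeriv T u u')
    (hw : ∀ t ∈ Icc 0 T, ∀ᵐ x ∂(volume.restrict Ω), ‖w t x‖ ≤ M)
    (hu : ∀ t ∈ Icc 0 T, ∀ᵐ x ∂(volume.restrict Ω), ‖u t x‖ ≤ M)
    (h0 : ∀ᵐ x ∂(volume.restrict Ω), dot (w 0 x) (u 0 x) = 0)
    (h : ∀ᵐ t ∂(volume.restrict (Icc 0 T)),
      2 * ∫ x in Ω, dot (w t x) (u t x) * (dot (u t x) (w' t x) + dot (w t x) (u' t x))
        ≤ C * ∫ x in Ω, dot (w t x) (u t x) * dot (w t x) (u t x)) :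
    ∀ t ∈ Icc 0 T, ∀ᵐ x ∂(volume.restrict Ω), dot (w t x) (u t x) = 0 := by
  intro t ht
  have hT0 : 0 ≤ T := ht.1.trans ht.2
  have hT : (0 : ℝ) ∈ Icc 0 T := ⟨le_rfl, hT0⟩
  refine pairEnergy_eq_zero (hw t ht) (hu t ht) hb ?_
  have cw := hwt.continuousOn hT0
  have cu := hut.continuousOn hT0
  have cw1 : ContinuousOn (fun q : ℝ × ℝ => w q.1) (Icc 0 T ×ˢ Icc 0 T) :=
    cw.comp continuousOn_fst fun q hq => hq.1
  have cw2 : ContinuousOn (fun q : ℝ × ℝ => w q.2) (Icc 0 T ×ˢ Icc 0 T) :=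
    cw.comp continuousOn_snd fun q hq => hq.2
  have cu1 : ContinuousOn (fun q : ℝ × ℝ => u q.1) (Icc 0 T ×ˢ Icc 0 T) :=
    cu.comp continuousOn_fst fun q hq => hq.1
  have cu2 : ContinuousOn (fun q : ℝ × ℝ => u q.2) (Icc 0 T ×ˢ Icc 0 T) :=
    cu.comp continuousOn_snd fun q hq => hq.2
  obtain ⟨hpi, hE⟩ := sub_eq_integral_of_increment_eq (E := fun t => pairEnergy (w t) (u t))
    (X := fun t s => mul3 (w t) (u t) (u t) + mul3 (w s) (u s) (u t))
    (Y := fun t s => mul3 (w t) (u t) (w s) + mul3 (w s) (u s) (w s))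
    hwt.1 hwt.2 hut.1 hut.2
    ((continuousOn_mul3 cw1 cu1 cu1 (fun q hq => hw _ hq.1) (fun q hq => hu _ hq.1)
      (fun q hq => hu _ hq.1)).add
      (continuousOn_mul3 cw2 cu2 cu1 (fun q hq => hw _ hq.2) (fun q hq => hu _ hq.2)
      (fun q hq => hu _ hq.1)))
    ((continuousOn_mul3 cw1 cu1 cw2 (fun q hq => hw _ hq.1) (fun q hq => hu _ hq.1)
      (fun q hq => hw _ hq.2)).add
      (continuousOn_mul3 cw2 cu2 cw2 (fun q hq => hw _ hq.2) (fun q hq => hu _ hq.2)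
      (fun q hq => hw _ hq.2)))
    (fun s hs t ht => pairEnergy_sub (hw t ht) (hu t ht) (hw s hs) (hu s hs))
  have hE0 : pairEnergy (w 0) (u 0) = 0 := by
    rw [pairEnergy_eq (hw 0 hT) (hu 0 hT)]
    refine integral_eq_zero_of_ae ?_
    filter_upwards [h0] with x hx
    simp [hx]
  have cE : ContinuousOn (fun t => pairEnergy (w t) (u t)) (Icc 0 T) :=
    cw.inner (continuousOn_mul3 cw cu cu hw hu hu)
  refine eq_zero_of_le_integral (C := C) cE (fun t ht => ?_) (fun t ht => ?_) ht
  · rw [pairEnergy_eq (hw t ht) (hu t ht)]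
    exact integral_nonneg fun x => mul_self_nonneg _
  · have h1 := hE t ht
    simp only [hE0, sub_zero] at h1
    rw [h1, ← intervalIntegral.integral_const_mul]
    refine intervalIntegral.integral_mono_ae_restrict ht.1 (intervalIntegrable_of_mem_Icc hpi hT ht)
      ((intervalIntegrable_of_mem_Icc cE.integrableOn_Icc hT ht).const_mul C) ?_
    refine ae_restrict_of_ae_restrict_of_subset (Icc_subset_Icc_right ht.2) ?_
    filter_upwards [h, ae_restrict_mem measurableSet_Icc] with r hr hrT
    rw [energy_rate_eq (hw r hrT) (hu r hrT), pairEnergy_eq (hw r hrT) (hu r hrT)]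
    exact hr

theorem eq_zero_on_closure {f : E3 → ℝ} (hΩ : IsOpen Ω) (hf : ContinuousOn f (closure Ω))
    (h : f =ᵐ[volume.restrict Ω] 0) : ∀ x ∈ closure Ω, f x = 0 := by
  have h1 : EqOn f 0 Ω := Measure.eqOn_open_of_ae_eq h hΩ (hf.mono subset_closure)
    continuousOn_const
  have h2 : EqOn f 0 (closure Ω) := h1.of_subset_closure hf continuousOn_const subset_closure
    subset_rfl
  exact h2

/-- The energy inequality at a fixed time, along the approximate equation. -/
theorem energy_rate_le (hΩ : IsSmoothBoundedDomain Ω) {u u' w w' v₁ v θ f f' : L2 Ω} {ε M N : ℝ}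
    (hε : 0 < ε) (hu : ∀ᵐ x ∂(volume.restrict Ω), ‖u x‖ = 1)
    (hu' : ∀ᵐ x ∂(volume.restrict Ω), u' x = cross (u x) (wlap u x)) (hv₁ : v₁ = tangProj u u')
    (hv : v = tangProj u f) (hθ : θ = tangProj u f')
    (hw : ∀ᵐ x ∂(volume.restrict Ω), w' x + dot (w x) (v₁ x) • u x =
        ε • (wlap w x + (2 * ∑ j, dot (wpd j u x) (wpd j w x)) • u x
              + dot (wlap u x) (w x) • u x + energyDensity u x • w x)
          + cross (u x) (wlap w x + energyDensity u x • w x)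
          + (ε • remainder u v θ x + cross (u x) (remainder u v θ x)))
    (huW : MemW 1 u) (hwW : MemW 3 w) (hNu : NeumannZero u) (hNw : NeumannZero w)
    (hM : ∀ j, ∀ᵐ x ∂(volume.restrict Ω), ‖wpd j u x‖ ≤ M)
    (hN : ∀ᵐ x ∂(volume.restrict Ω), ‖w x‖ ≤ N) :
    2 * ∫ x in Ω, dot (w x) (u x) * (dot (u x) (w' x) + dot (w x) (u' x))
      ≤ 2 * (ε * (3 * M ^ 2)) * ∫ x in Ω, dot (w x) (u x) * dot (w x) (u x) := by
  have hop := hΩ.isOpen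
  have hb := hΩ.isBounded
  obtain ⟨C, hC, hs⟩ := hΩ.sobolev
  have wu := huW.isWeakPartial_wpd hop
  have hdu : ∀ j, EssBdd Ω (wpd j u) := fun j => EssBdd.of_L2 (hM j)
  have htan : ∀ j, ∀ᵐ x ∂(volume.restrict Ω), dot (wpd j u x) (u x) = 0 := fun j =>
    dot_wpd_eq_zero hop hb hu (hdu j) (wu j)
  have hR := dot_remainder hu htan (hv ▸ dot_tangProj hu f) (hθ ▸ dot_tangProj hu f')
  have hrate := dot_time_deriv hu hu' hv₁ hR hw
  -- The bound on ∂_j w, from w ∈ W^{3,2}, only justifies the Leibniz rule. It does not enter the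
  -- constant, so it need not be uniform in time.
  have hen := energy_inequality hop hb (EssBdd.of_L2 (M := 1) (hu.mono fun x hx => hx.le))
    (EssBdd.of_L2 hN) hdu (fun j => EssBdd.of_L2 (hs _ (hwW.wpd hop j))) wu
    (hwW.isWeakPartial_wpd hop) hNu hNw hM
  have e : ∫ x in Ω, dot (w x) (u x) * (dot (u x) (w' x) + dot (w x) (u' x))
      = ε * ∫ x in Ω, dot (w x) (u x) * (dot (wlap w x) (u x)
        + 2 * ∑ j, dot (wpd j u x) (wpd j w x)
        + dot (wlap u x) (w x) + energyDensity u x * dot (w x) (u x)) := by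
    rw [← integral_const_mul]
    refine integral_congr_ae (hrate.mono fun x hx => ?_)
    simp only [hx, mul_left_comm]
  rw [e, mul_assoc 2, mul_assoc ε]
  exact mul_le_mul_of_nonneg_left (mul_le_mul_of_nonneg_left hen hε.le) zero_le_two

end Energy

end LLFlow

end

/-! ### The proposition -/

theorem proposition6p2
    (Ω : Set E3) (hΩ : IsSmoothBoundedDomain Ω)
    (T₀ : ℝ) (hT₀ : 0 < T₀)
    (k : ℕ) (hk : 1 ≤ k)
    (ε : ℝ) (hε : 0 < ε)
    -- the underlying regular solution of the Landau-Lifshitz equation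
    (u : ℝ → L2 Ω) (hu : IsLLSolution T₀ u) (huT : PropertyT T₀ k u)
    -- `v i = ∇_t^i u` for `i ≤ k + 1` and `θ i = ∇_t^i τ(u)` for `i ≤ k`
    (v : ℕ → ℝ → L2 Ω) (hv : IsCovTimeJet T₀ u u (k + 1) v)
    (θ : ℕ → ℝ → L2 Ω) (hθ : IsCovTimeJet T₀ u (fun t => tension (u t)) k θ)
    -- the solution of the approximate problem
    (ω : ℝ → L2 Ω) (hω2 : MemC0W T₀ 2 ω) (hω3 : MemLpW T₀ 2 3 ω)
    (hω : IsApproxSolution T₀ ε u (v 1) (fun t => remainder (u t) (v k t) (θ k t)) (v k 0) ω) :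
    ∀ t ∈ Icc 0 T₀,
      -- `⟨ω,u⟩ = 0` almost everywhere on `Ω`
      (∀ᵐ x ∂(volume.restrict Ω), dot (ω t x) (u t x) = 0) ∧
      -- and everywhere on the closure of `Ω` for the continuous representatives
      ∀ w y : E3 → E3, ContinuousOn w (closure Ω) → ContinuousOn y (closure Ω) →
        w =ᵐ[volume.restrict Ω] ω t → y =ᵐ[volume.restrict Ω] u t →
          ∀ x ∈ closure Ω, dot (w x) (y x) = 0 := by
  have hop := hΩ.isOpen
  have hb := hΩ.isBounded
  have h0T : (0 : ℝ) ∈ Icc 0 T₀ := ⟨le_rfl, hT₀.le⟩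
  -- For k ≥ 1 both ∇_t^k u and ∇_t^k τ(u) are projections at almost every time, hence tangent; for
  -- k = 0 the first would be u itself.
  obtain ⟨k, rfl⟩ : ∃ k', k = k' + 1 := ⟨k - 1, by omega⟩
  obtain ⟨hv0, hvs⟩ := hv
  obtain ⟨-, hθs⟩ := hθ
  obtain ⟨u', hut, hv1⟩ := hvs 0 (by omega)
  rw [hv0] at hut
  obtain ⟨g, -, hvk⟩ := hvs k (by omega)
  obtain ⟨_, hvkt, -⟩ := hvs (k + 1) (by omega)
  obtain ⟨q, -, hθk⟩ := hθs k (by omega)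
  obtain ⟨u'', hut', hueq⟩ := hu.eqn
  obtain ⟨ω', hωt, hωeq⟩ := hω.eqn
  obtain ⟨D, hD0, -, hDW⟩ := huT
  have huW := hDW 0 (by omega)
  rw [hD0] at huW
  have hcu := hut.continuousOn hT₀.le
  have husph : ∀ t ∈ Icc 0 T₀, ∀ᵐ x ∂(volume.restrict Ω), ‖u t x‖ = 1 :=
    forall_ae_of_ae_ae (P := fun p _ => ‖p‖ = 1) (isClosed_eq (by fun_prop) continuous_const)
      hT₀ hcu hcu hu.sphere
  have hinit : ∀ᵐ x ∂(volume.restrict Ω), dot (ω 0 x) (u 0 x) = 0 := by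
    rw [hω.initial]
    -- Tangency of v_k is known only at almost every time. The jet goes one order further, so v_k is
    -- continuous in L² and tangency holds at time 0 too.
    refine forall_ae_of_ae_ae (P := fun p q => dot p q = 0)
      (isClosed_eq (continuous_fst.inner continuous_snd) continuous_const)
      hT₀ (hvkt.continuousOn hT₀.le) hcu ?_ 0 h0T
    filter_upwards [hvk, hu.sphere] with t h1 h2
    rw [h1]
    exact dot_tangProj h2 _
  obtain ⟨Mω, hMω⟩ := hω2.exists_bound hΩ
  obtain ⟨M, hM⟩ := huW.exists_bound_wpd hΩ (by omega)
  -- `max Mω 1` bounds both ω and the unit field u. In `C`, the 2 comes from differentiating a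
  -- square and 3M² bounds |∂u|² over three directions.
  have main := dot_eq_zero_of_energy (C := 2 * (ε * (3 * M ^ 2))) (M := max Mω 1) hb hωt hut
    (fun t ht => (hMω t ht).mono fun x hx => hx.trans (le_max_left _ _))
    (fun t ht => (husph t ht).mono fun x hx => hx.le.trans (le_max_right _ _)) hinit (by
      filter_upwards [ae_restrict_mem measurableSet_Icc, hu.sphere, hut.unique hut', hueq,
        hv1, hvk, hθk, hωeq, hM, huW.1, hω3.1, hu.neumann, hω.neumann]
        with t ht hsph huu hueq hv1 hvk hθk hωeq hM huW hωW hNu hNω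
      exact energy_rate_le hΩ hε hsph (by rw [huu]; exact hueq) hv1 hvk hθk hωeq
        (huW.mono (by omega)) hωW hNu hNω hM (hMω t ht))
  intro t ht
  refine ⟨main t ht, fun w y hw hy hwω hyu => ?_⟩
  refine eq_zero_on_closure hop (hw.inner hy) ?_
  filter_upwards [main t ht, hwω, hyu] with x h1 h2 h3
  rw [h2, h3]
  exact h1
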